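/- \textbf{Conventions.} A 2-crossed module $\mathcal A=(L\xrightarrow{\delta}E\xrightarrow{\partial}G,\triangleright,\{,\})$ is a complex of groups with left actions $\triangleright$ of $G$ by automorphisms on $L$ and $E$ (and by conjugation on $G$) for which $\delta,\partial$ are equivariant, and a $G$-equivariant map $\{,\}\colon E\times E\to L$ such that, writing $e\triangleright' l=l\{\delta(l)^{-1},e\}$: $\delta\{e,f\}=efe^{-1}\,(\partial(e)\triangleright f^{-1})$; $\{\delta l,\delta k\}=lkl^{-1}k^{-1}$; $\{\delta l,e\}\{e,\delta l\}=l\,(\partial(e)\triangleright l^{-1})$; $\{ef,g\}=\{e,fgf^{-1}\}\,\partial(e)\triangleright\{f,g\}$; $\{e,fg\}=\{e,f\}\,(\partial(e)\triangleright f)\triangleright'\{e,g\}$. A map of 2-crossed modules is a triple $f=(\mu,\psi,\phi)$ of group morphisms on $L,E,G$ commuting with $\delta$, $\partial$, the actions and $\{,\}$. Let $\mathcal A'=(L'\to E'\xrightarrow{\partial}F)$ and $\mathcal A=(L\xrightarrow{\delta} E\xrightarrow{\partial} G)$ be 2-crossed modules. For a map $f=(\mu,\psi,\phi)\colon\mathcal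 A'\to\mathcal A$, a quadratic $f$-derivation is a pair of set maps $s\colon F\to E$, $t\colon E'\to L$ with $$s(gh)=(\phi(h)^{-1}\triangleright s(g))\,s(h),$$ $$t(ab)=\big(\psi(b)s(\partial b)\big)^{-1}\triangleright'\Big(\{\psi(b),\phi(\partial b)^{-1}\triangleright s(\partial a)^{-1}\}\,t(a)\Big)\,t(b),$$ $$t(g\triangleright a)=\phi(g)\triangleright\Big(\big(s(g)s(\partial a)^{-1}\big)\triangleright'\{\psi(a)^{-1},s(g)^{-1}\}^{-1}\Big)\;\phi(g)\triangleright\{s(g),s(\partial a)^{-1}\psi(a)^{-1}\}\;\big(\phi(g)\,\partial(s(g))\big)\triangleright t(a).$$ It is a homotopy $f\to f'=(\mu',\psi',\phi')$ if $\mu'(l)=\mu(l)\,t(\delta l)$, $\psi'(a)=\psi(a)\,s(\partial a)\,\delta(t(a))$ and $\phi'(g)=\phi(g)\,\partial(s(g))$. A 2-fold homotopy $(s,t)\to(\hat s,\hat t)$ between homotopies $f\to f'$ is a quadratic 2-derivation, i.e. a map $k\colon F\to L$ with $k(gh)=\big(s(h)^{-1}\triangleright'(\phi(h)^{-1}\triangleright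 k(g))\big)k(h)$, such that $\hat s(g)=s(g)\,\delta(k(g))$ and $\hat t(e)=k(\partial e)^{-1}t(e)$. For a left action of $H$ on $N$ by automorphisms, $H\ltimes N$ carries the product $(h,n)(h',n')=(hh',(h'^{-1}\triangleright n)n')$. The group $G\ltimes_\triangleright E$ acts by automorphisms on $E\ltimes_{\triangleright'}L$ by $(g,x)\bullet(e,k)=\big(g\triangleright(xex^{-1}),\,g\triangleright(\{x,e^{-1}\}\,\partial(x)\triangleright k)\big)$. \textbf{Theorem (mapping space 2-groupoid).} Let $\mathcal A'=(L'\to E'\to F)$ be a 2-crossed module with $F$ a free group with chosen basis $B$, and let $\mathcal A$ be any 2-crossed module. There is a 2-groupoid $\mathrm{HOM}_B(\mathcal A',\mathcal A)$ (a strict 2-category in which all 1-morphisms are strictly invertible and all 2-morphisms are invertible) whose objects are the 2-crossed module maps $\mathcal A'\to\mathcal A$, whose 1-morphisms $f\to f'$ are the homotopies, and whose 2-morphisms are the 2-fold homotopies, with the following operations. (1) The unit of $f$ is $s=1$, $t=1$. The concatenation of $(s,t)\colon f\to f'$ and $(s',t')\colon f'\to f''$ is $(s\otimes s',t\otimes t')\colon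 f\to f''$, where $s\otimes s'$ is determined by $(s\otimes s')(b)=s(b)s'(b)$ for $b\in B$, and $$(t\otimes t')(e)=\omega^{(s,s')}(\partial e)\;\big(s'(\partial e)^{-1}\triangleright' t(e)\big)\;t'(e).$$ Here $\omega^{(s,s')}\colon F\to L$ is the last component of the group morphism $F\to (G\ltimes_\triangleright E)\ltimes_\bullet(E\ltimes_{\triangleright'}L)$ with $b\mapsto(\phi(b),s(b),s'(b),1)$ for $b\in B$. (2) The vertical composite of 2-fold homotopies $k$, $k'$ is $g\mapsto k(g)k'(g)$, with units $k=1$. (3) Whiskering $k$, between homotopies $f\to f'$, with a homotopy $(u,v)\colon f'\to f''$ on the right gives the quadratic 2-derivation with value $u(b)^{-1}\triangleright' k(b)$ at each $b\in B$. Whiskering $k$ with a homotopy $(u,v)\colon f''\to f$ on the left gives the quadratic 2-derivation with value $k(b)$ at each $b\in B$. These whiskerings satisfy the interchange law. The construction depends on $B$: there are $\mathcal A'$, $\mathcal A$ and two bases of $F$ for which the operations above do not coincide. -/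

import Mathlib

open CategoryTheory

universe uL uE uG uL' uE' uG' u v w

/-- A 2-crossed module of groups `L --δ--> E --d--> G`: a complex of groups with actions of `G` on
`E` and `L` by automorphisms (and on itself by conjugation) for which `δ` and `d` are equivariant,
and a `G`-equivariant Peiffer lifting `E × E → L`. In the last axiom the expression
`l * peiffer (δ l)⁻¹ x` is the secondary action `x ▷' l` of `E` on `L`. -/
structure TwoCrossedModule where
  L : Type uL
  E : Type uE
  G : Type uG
  [groupL : Group L]
  [groupE : Group E]
  [groupG : Group G]
  [actL : MulDistribMulAction G L]
  [actE : MulDistribMulAction G E]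
  δ : L →* E
  d : E →* G
  peiffer : E → E → L
  d_δ : ∀ l : L, d (δ l) = 1
  δ_smul : ∀ (g : G) (l : L), δ (g • l) = g • δ l
  d_smul : ∀ (g : G) (e : E), d (g • e) = g * d e * g⁻¹
  smul_peiffer : ∀ (g : G) (e f : E), g • peiffer e f = peiffer (g • e) (g • f)
  δ_peiffer : ∀ e f : E, δ (peiffer e f) = e * f * e⁻¹ * d e • f⁻¹
  peiffer_δ_δ : ∀ l k : L, peiffer (δ l) (δ k) = l * k * l⁻¹ * k⁻¹
  peiffer_δ_mul_peiffer_δ : ∀ (e : E) (l : L),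
    peiffer (δ l) e * peiffer e (δ l) = l * d e • l⁻¹
  peiffer_mul_left : ∀ e f g : E,
    peiffer (e * f) g = peiffer e (f * g * f⁻¹) * d e • peiffer f g
  peiffer_mul_right : ∀ e f g : E,
    peiffer e (f * g) =
      peiffer e f * (peiffer e g * peiffer (δ (peiffer e g))⁻¹ (d e • f))

/-- The semidirect product of a left action of `H` on `N` by automorphisms, with the convention
`(h, n) (h', n') = (h h', (h'⁻¹ ▷ n) n')`. -/
@[ext]
structure LeftSemidirect {N : Type u} {H : Type v} [Group N] [Group H] (a : H →* MulAut N) where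
  fst : H
  snd : N

namespace LeftSemidirect

variable {N : Type u} {H : Type v} [Group N] [Group H] {a : H →* MulAut N}

instance : Mul (LeftSemidirect a) := ⟨fun x y => ⟨x.fst * y.fst, a y.fst⁻¹ x.snd * y.snd⟩⟩
instance : One (LeftSemidirect a) := ⟨⟨1, 1⟩⟩
instance : Inv (LeftSemidirect a) := ⟨fun x => ⟨x.fst⁻¹, a x.fst x.snd⁻¹⟩⟩

@[simp] theorem mul_fst (x y : LeftSemidirect a) : (x * y).fst = x.fst * y.fst := rfl
@[simp] theorem mul_snd (x y : LeftSemidirect a) :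
    (x * y).snd = a y.fst⁻¹ x.snd * y.snd := rfl
@[simp] theorem one_fst : (1 : LeftSemidirect a).fst = 1 := rfl
@[simp] theorem one_snd : (1 : LeftSemidirect a).snd = 1 := rfl
@[simp] theorem inv_fst (x : LeftSemidirect a) : x⁻¹.fst = x.fst⁻¹ := rfl
@[simp] theorem inv_snd (x : LeftSemidirect a) : x⁻¹.snd = a x.fst x.snd⁻¹ := rfl

instance : Group (LeftSemidirect a) :=
  Group.ofLeftAxioms
    (fun x y z => by ext <;> simp [mul_assoc])
    (fun x => by ext <;> simp)
    (fun x => by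
      ext
      · simp
      · simp only [mul_snd, inv_snd, one_snd, map_inv]
        simp)

end LeftSemidirect

namespace TwoCrossedModule

attribute [instance] groupL groupE groupG actL actE

section Constructions

variable (A : TwoCrossedModule.{uL, uE, uG})

/-- The secondary action `e ▷' l = l {δ(l)⁻¹, e}`, as a function. -/
def sec (e : A.E) (l : A.L) : A.L := l * A.peiffer (A.δ l)⁻¹ e

theorem peiffer_one_left (e : A.E) : A.peiffer 1 e = 1 := by
  have h := A.peiffer_mul_left 1 1 e
  simpa using h

theorem peiffer_one_right (e : A.E) : A.peiffer e 1 = 1 := by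
  have h := A.peiffer_mul_right e 1 1
  have h1 : A.δ (A.peiffer e 1) = 1 := by rw [A.δ_peiffer]; simp
  simpa [h1, peiffer_one_left] using h

theorem peiffer_mul_right_sec (e f g : A.E) :
    A.peiffer e (f * g) = A.peiffer e f * A.sec (A.d e • f) (A.peiffer e g) :=
  A.peiffer_mul_right e f g

theorem δ_sec (e : A.E) (l : A.L) : A.δ (A.sec e l) = e * A.δ l * e⁻¹ := by
  simp [sec, A.δ_peiffer, A.d_δ, mul_assoc]

theorem sec_δ (k l : A.L) : A.sec (A.δ k) l = k * l * k⁻¹ := by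
  rw [sec, ← map_inv, A.peiffer_δ_δ]; group

theorem sec_eq (e : A.E) (l : A.L) :
    A.sec e l = A.d e • l * (A.peiffer e (A.δ l)⁻¹)⁻¹ := by
  have h := A.peiffer_δ_mul_peiffer_δ e l⁻¹
  rw [map_inv, inv_inv] at h
  rw [sec, eq_mul_inv_iff_mul_eq, mul_assoc, h]; group

theorem sec_one (l : A.L) : A.sec 1 l = l := by
  rw [sec, peiffer_one_right, mul_one]

theorem sec_mul_left (e f : A.E) (l : A.L) : A.sec (e * f) l = A.sec e (A.sec f l) := by
  rw [A.sec_eq e (A.sec f l), δ_sec, A.sec_eq f l, A.sec_eq (e * f) l, A.peiffer_mul_left]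
  simp only [map_mul, mul_smul, smul_mul', smul_inv', mul_inv_rev, inv_inv, mul_assoc]

theorem sec_mul_right (e : A.E) (l k : A.L) : A.sec e (l * k) = A.sec e l * A.sec e k := by
  have h : A.d e • (A.δ k)⁻¹ = A.δ (A.d e • k⁻¹) := by rw [A.δ_smul, map_inv]
  rw [A.sec_eq e (l * k), A.sec_eq e l, A.sec_eq e k, map_mul, mul_inv_rev,
    A.peiffer_mul_right_sec, h, sec_δ]
  simp only [smul_mul', smul_inv']
  group

theorem smul_sec (g : A.G) (e : A.E) (l : A.L) : g • A.sec e l = A.sec (g • e) (g • l) := by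
  simp only [sec, smul_mul', A.smul_peiffer, A.δ_smul, smul_inv']

/-- The secondary action of `E` on `L`, an action by automorphisms. -/
def secAut : A.E →* MulAut A.L where
  toFun e :=
    { toFun := A.sec e
      invFun := A.sec e⁻¹
      left_inv := fun l => by rw [← sec_mul_left, inv_mul_cancel, sec_one]
      right_inv := fun l => by rw [← sec_mul_left, mul_inv_cancel, sec_one]
      map_mul' := A.sec_mul_right e }
  map_one' := by ext l; exact A.sec_one l
  map_mul' e f := by ext l; exact A.sec_mul_left e f l

/-- The group `G ⋉ E`, the underlying group of the path space of `A`. -/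
abbrev PathGroup := LeftSemidirect (MulDistribMulAction.toMulAut A.G A.E)

/-- The group `E ⋉ L` of the secondary action. -/
abbrev SecGroup := LeftSemidirect A.secAut

/-- The lifted action of `G ⋉ E` on the subgroup `{1} ⋉ (E ⋉ L)` of the second group of the path
space: `(g, x) • (e, k) = (g ▷ (x e x⁻¹), g ▷ ({x, e⁻¹} (∂ x ▷ k)))`, as a function. -/
def liftedFun (p : A.PathGroup) (y : A.SecGroup) : A.SecGroup :=
  ⟨p.fst • (p.snd * y.fst * p.snd⁻¹),
    p.fst • (A.peiffer p.snd y.fst⁻¹ * A.d p.snd • y.snd)⟩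

theorem liftedFun_one (y : A.SecGroup) : A.liftedFun 1 y = y := by
  ext <;> simp [liftedFun, peiffer_one_left]

theorem liftedFun_mul_left (p q : A.PathGroup) (y : A.SecGroup) :
    A.liftedFun (p * q) y = A.liftedFun p (A.liftedFun q y) := by
  have hq : ∀ z : A.E, (q.fst * A.d (q.fst⁻¹ • z)) = A.d z * q.fst := fun z => by
    rw [A.d_smul]; group
  ext
  · simp [liftedFun, mul_smul, mul_assoc, smul_mul']
  · simp only [liftedFun, LeftSemidirect.mul_fst, LeftSemidirect.mul_snd,
      MulDistribMulAction.toMulAut_apply, MulDistribMulAction.toMulEquiv_apply]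
    rw [A.peiffer_mul_left, map_mul]
    simp only [smul_mul', A.smul_peiffer, mul_smul, smul_inv', smul_inv_smul, mul_inv_rev,
      inv_inv, mul_assoc, A.d_smul]

theorem liftedFun_mul_right (p : A.PathGroup) (y z : A.SecGroup) :
    A.liftedFun p (y * z) = A.liftedFun p y * A.liftedFun p z := by
  have key : ∀ (x f : A.E) (m : A.L),
      A.peiffer x f * A.sec (A.d x • f) m = A.sec (x * f * x⁻¹) m * A.peiffer x f := by
    intro x f m
    have h : x * f * x⁻¹ = A.δ (A.peiffer x f) * (A.d x • f) := by
      rw [A.δ_peiffer, smul_inv']; group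
    rw [h, sec_mul_left, sec_δ]; group
  ext
  · simp [liftedFun, mul_assoc, smul_mul']
  · change p.fst • (A.peiffer p.snd (y.fst * z.fst)⁻¹ *
        A.d p.snd • (A.sec z.fst⁻¹ y.snd * z.snd)) =
      A.sec (p.fst • (p.snd * z.fst * p.snd⁻¹))⁻¹
        (p.fst • (A.peiffer p.snd y.fst⁻¹ * A.d p.snd • y.snd)) *
        p.fst • (A.peiffer p.snd z.fst⁻¹ * A.d p.snd • z.snd)
    rw [← smul_inv', ← A.smul_sec, ← smul_mul']
    congr 1
    rw [mul_inv_rev, A.peiffer_mul_right_sec, smul_mul', A.smul_sec, sec_mul_right]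
    have h : (p.snd * z.fst * p.snd⁻¹)⁻¹ = p.snd * z.fst⁻¹ * p.snd⁻¹ := by group
    have k1 := key p.snd z.fst⁻¹ (A.peiffer p.snd y.fst⁻¹)
    have k2 := key p.snd z.fst⁻¹ (A.d p.snd • y.snd)
    rw [h, k1]
    calc _ = A.sec (p.snd * z.fst⁻¹ * p.snd⁻¹) (A.peiffer p.snd y.fst⁻¹) *
          (A.peiffer p.snd z.fst⁻¹ * A.sec (A.d p.snd • z.fst⁻¹) (A.d p.snd • y.snd)) *
          A.d p.snd • z.snd := by simp only [mul_assoc]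
      _ = _ := by rw [k2]; simp only [mul_assoc]

/-- The lifted action of `G ⋉ E` on `E ⋉ L` by automorphisms. -/
def liftedAut : A.PathGroup →* MulAut A.SecGroup where
  toFun p :=
    { toFun := A.liftedFun p
      invFun := A.liftedFun p⁻¹
      left_inv := fun y => by rw [← liftedFun_mul_left, inv_mul_cancel, liftedFun_one]
      right_inv := fun y => by rw [← liftedFun_mul_left, mul_inv_cancel, liftedFun_one]
      map_mul' := A.liftedFun_mul_right p }
  map_one' := by ext1 y; exact A.liftedFun_one y
  map_mul' p q := by ext1 y; exact A.liftedFun_mul_left p q y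

/-- The underlying group `(G ⋉ E) ⋉ ({1} ⋉ (E ⋉ L))` of the triangle space of `A`. -/
abbrev TriangleGroup := LeftSemidirect A.liftedAut

end Constructions

/-- Morphisms of 2-crossed modules. -/
@[ext]
structure Hom (A' : TwoCrossedModule.{uL', uE', uG'}) (A : TwoCrossedModule.{uL, uE, uG}) where
  μ : A'.L →* A.L
  ψ : A'.E →* A.E
  φ : A'.G →* A.G
  δ_μ : ∀ l, A.δ (μ l) = ψ (A'.δ l)
  d_ψ : ∀ e, A.d (ψ e) = φ (A'.d e)
  μ_smul : ∀ g l, μ (g • l) = φ g • μ l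
  ψ_smul : ∀ g e, ψ (g • e) = φ g • ψ e
  μ_peiffer : ∀ e f, μ (A'.peiffer e f) = A.peiffer (ψ e) (ψ f)

section Homotopies

variable {A' : TwoCrossedModule.{uL', uE', uG'}} {A : TwoCrossedModule.{uL, uE, uG}}

/-- `(s, t)` is a quadratic `f`-derivation. -/
structure IsQuadraticDerivation (f : Hom A' A) (s : A'.G → A.E) (t : A'.E → A.L) : Prop where
  s_mul : ∀ g h, s (g * h) = (f.φ h)⁻¹ • s g * s h
  t_mul : ∀ a b, t (a * b) =
    A.sec (f.ψ b * s (A'.d b))⁻¹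
      (A.peiffer (f.ψ b) (f.φ (A'.d b)⁻¹ • (s (A'.d a))⁻¹) * t a) * t b
  t_smul : ∀ g a, t (g • a) =
    f.φ g • A.sec (s g * (s (A'.d a))⁻¹) (A.peiffer (f.ψ a)⁻¹ (s g)⁻¹)⁻¹ *
      f.φ g • A.peiffer (s g) ((s (A'.d a))⁻¹ * (f.ψ a)⁻¹) *
      (f.φ g * A.d (s g)) • t a

/-- A (1-fold, pointed) homotopy from `f` to `f'`: a quadratic `f`-derivation connecting `f` and
`f'`. -/
@[ext]
structure Homotopy (f f' : Hom A' A) where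
  s : A'.G → A.E
  t : A'.E → A.L
  isQuadraticDerivation : IsQuadraticDerivation f s t
  μ_eq : ∀ l, f'.μ l = f.μ l * t (A'.δ l)
  ψ_eq : ∀ a, f'.ψ a = f.ψ a * s (A'.d a) * A.δ (t a)
  φ_eq : ∀ g, f'.φ g = f.φ g * A.d (s g)

/-- A 2-fold homotopy between two homotopies `p` and `q` from `f` to `f'`: a quadratic
2-derivation for `(f, p.s, p.t)` connecting `p` and `q`. -/
@[ext]
structure TwoFoldHomotopy {f f' : Hom A' A} (p q : Homotopy f f') where
  k : A'.G → A.L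
  k_mul : ∀ g h, k (g * h) = A.sec (p.s h)⁻¹ ((f.φ h)⁻¹ • k g) * k h
  s_eq : ∀ g, q.s g = p.s g * A.δ (k g)
  t_eq : ∀ e, q.t e = (k (A'.d e))⁻¹ * p.t e

variable {ι : Type w} (b : FreeGroupBasis ι A'.G)

/-- The group morphism from the free group on the basis `b` to the underlying group of the triangle
space which is `(φ(b), s(b), 1, s'(b), 1)` on the basis. -/
noncomputable def triangleHom {f f' f'' : Hom A' A} (p : Homotopy f f') (q : Homotopy f' f'') :
    A'.G →* A.TriangleGroup :=
  b.lift fun i => ⟨⟨f.φ (b i), p.s (b i)⟩, ⟨q.s (b i), 1⟩⟩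

/-- The map `ω^{(s,s')}` from the free group to `L`: the last component of `triangleHom`. -/
noncomputable def omega {f f' f'' : Hom A' A} (p : Homotopy f f') (q : Homotopy f' f'')
    (g : A'.G) : A.L :=
  (triangleHom b p q g).snd.snd

end Homotopies

/-- A (strict) 2-groupoid: a strict 2-category in which all 1-morphisms are (strictly) invertible
and all 2-morphisms are invertible. -/
structure IsTwoGroupoid (C : Type u) [Bicategory.{w, v} C] : Prop where
  strict : Bicategory.Strict C
  exists_inv : ∀ {x y : C} (p : x ⟶ y), ∃ q : y ⟶ x, p ≫ q = 𝟙 x ∧ q ≫ p = 𝟙 y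
  locallyGroupoid : Bicategory.IsLocallyGroupoid C

/-- A bicategory structure on the set of 2-crossed module maps `A' → A`, together with
identifications `Φ` of its 1-morphisms with homotopies and `Ψ` of its 2-morphisms with 2-fold
homotopies, is the mapping space 2-groupoid of `A'` and `A` with respect to the basis `b`: it is a
2-groupoid, and its units, concatenations and whiskerings are the prescribed ones. (A derivation
and a quadratic 2-derivation on a free group are determined by their values on the basis.) -/
structure IsMappingTwoGroupoid
    {A' : TwoCrossedModule.{uL', uE', uG'}} {A : TwoCrossedModule.{uL, uE, uG}}
    {ι : Type u} (b : FreeGroupBasis ι A'.G) (C : Bicategory.{w, v} (Hom A' A))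
    (Φ : ∀ {f f' : Hom A' A}, (f ⟶ f') ≃ Homotopy f f')
    (Ψ : ∀ {f f' : Hom A' A} {p q : f ⟶ f'}, (p ⟶ q) ≃ TwoFoldHomotopy (Φ p) (Φ q)) :
    Prop where
  isTwoGroupoid : IsTwoGroupoid (Hom A' A)
  id_s : ∀ (f : Hom A' A) (g : A'.G), (Φ (𝟙 f)).s g = 1
  id_t : ∀ (f : Hom A' A) (e : A'.E), (Φ (𝟙 f)).t e = 1
  comp_s : ∀ {f f' f'' : Hom A' A} (p : f ⟶ f') (q : f' ⟶ f'') (i : ι),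
    (Φ (p ≫ q)).s (b i) = (Φ p).s (b i) * (Φ q).s (b i)
  comp_t : ∀ {f f' f'' : Hom A' A} (p : f ⟶ f') (q : f' ⟶ f'') (e : A'.E),
    (Φ (p ≫ q)).t e =
      omega b (Φ p) (Φ q) (A'.d e) * A.sec ((Φ q).s (A'.d e))⁻¹ ((Φ p).t e) * (Φ q).t e
  id_k : ∀ {f f' : Hom A' A} (p : f ⟶ f') (g : A'.G), (Ψ (𝟙 p)).k g = 1
  comp_k : ∀ {f f' : Hom A' A} {p q r : f ⟶ f'} (α : p ⟶ q) (β : q ⟶ r) (g : A'.G),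
    (Ψ (α ≫ β)).k g = (Ψ α).k g * (Ψ β).k g
  whiskerRight_k : ∀ {f f' f'' : Hom A' A} {p q : f ⟶ f'} (α : p ⟶ q) (r : f' ⟶ f'') (i : ι),
    (Ψ (C.whiskerRight α r)).k (b i) = A.sec ((Φ r).s (b i))⁻¹ ((Ψ α).k (b i))
  whiskerLeft_k : ∀ {f f' f'' : Hom A' A} (r : f ⟶ f') {p q : f' ⟶ f''} (α : p ⟶ q) (i : ι),
    (Ψ (C.whiskerLeft r α)).k (b i) = (Ψ α).k (b i)

end TwoCrossedModule

/-! A derivation over `φ` is the same as a group morphism from `F` to `G ⋉ E` lying over `φ`. A pair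
of composable derivations `s`, `s'` should therefore give a morphism to the triangle group `(G ⋉ E)
⋉ (E ⋉ L)`, and since `F` is free there is exactly one with prescribed values `(φ, s, s', 1)` on the
basis. Its first edge is `s` and its second edge `s'`, because faces are morphisms and agree on the
basis; the third face is a morphism too, hence a derivation, and it is the concatenation. The last
component `ω` measures how far pointwise multiplication is from being this concatenation: `s ⊗ s' =
s s' δ(ω)⁻¹`.

The hard point is that the concatenation of the `t`-components satisfies the two laws of a quadratic
derivation. Multiplicativity is the Peiffer identity `peiffer_comp_mul`. Equivariance,
`derivAct_comp`, is proved inside the triangle group, where both actions and the Peiffer lifting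
turn into conjugations and commutators of two copies of `E`, so that the claim becomes an equality
of words. Both laws are transferred by cancelling a common factor, so
`isQuadraticDerivation_comp_iff` is an equivalence, and it yields inverses as well as composites.

Units and associativity reduce to identities for `ω`. These follow from `eq_of_recursion`: both
sides obey one recursion and are `1` on the basis. Whiskering multiplies by `ω` on both sides, and
the 2-categorical axioms are then pointwise identities. For dependence on the basis, `F` is infinite
cyclic with generators `x` and `x⁻¹`: equal operations would force the symmetric group on three
letters to be commutative. -/

namespace TwoCrossedModule

/-! ### Peiffer calculus with the secondary action. -/

section Peiffer

variable (A : TwoCrossedModule.{uL, uE, uG})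

theorem sec_one_right (e : A.E) : A.sec e 1 = 1 := map_one (A.secAut e)

theorem sec_inv (e : A.E) (l : A.L) : A.sec e l⁻¹ = (A.sec e l)⁻¹ := map_inv (A.secAut e) l

theorem sec_inv_sec (e : A.E) (l : A.L) : A.sec e⁻¹ (A.sec e l) = l := by
  rw [← sec_mul_left, inv_mul_cancel, sec_one]

theorem sec_sec_inv (e : A.E) (l : A.L) : A.sec e (A.sec e⁻¹ l) = l := by
  rw [← sec_mul_left, mul_inv_cancel, sec_one]

theorem sec_injective (e : A.E) : Function.Injective (A.sec e) := (A.secAut e).injective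

theorem sec_δ_inv (k l : A.L) : A.sec (A.δ k)⁻¹ l = k⁻¹ * l * k := by
  rw [← map_inv, sec_δ, inv_inv]

/-- The Peiffer lifting intertwines the two conjugates of `f` by `e`. -/
theorem peiffer_mul_sec (e f : A.E) (m : A.L) :
    A.peiffer e f * A.sec (A.d e • f) m = A.sec (e * f * e⁻¹) m * A.peiffer e f := by
  have h : e * f * e⁻¹ = A.δ (A.peiffer e f) * (A.d e • f) := by
    rw [A.δ_peiffer, smul_inv']; group
  rw [h, sec_mul_left, sec_δ]; group

theorem peiffer_δ_left (l : A.L) (e : A.E) : A.peiffer (A.δ l) e = l * (A.sec e l)⁻¹ := by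
  rw [← sec_inv, sec, map_inv, inv_inv]; group

theorem peiffer_δ_right (e : A.E) (l : A.L) :
    A.peiffer e (A.δ l) = A.sec e l * (A.d e • l)⁻¹ := by
  have h := A.sec_eq e l⁻¹
  rw [map_inv, inv_inv, sec_inv, smul_inv', ← mul_inv_rev, inv_inj] at h
  rw [h, mul_inv_cancel_right]

theorem peiffer_δ_mul_right (e c : A.E) (j : A.L) :
    A.peiffer e (A.δ j * c) = A.sec e j * A.peiffer e c * (A.d e • j)⁻¹ := by
  rw [peiffer_mul_right_sec, peiffer_δ_right, ← A.δ_smul, sec_δ]; group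

/-- The conjugate in the axiom is `f * g * f⁻¹ = δ {f, g} * (d f • g)`; splitting off this boundary
trades the primary action on `{f, g}` for the secondary one. -/
theorem peiffer_mul_left_sec (e f g : A.E) :
    A.peiffer (e * f) g = A.sec e (A.peiffer f g) * A.peiffer e (A.d f • g) := by
  have h : f * g * f⁻¹ = A.δ (A.peiffer f g) * (A.d f • g) := by
    rw [A.δ_peiffer, smul_inv']; group
  rw [A.peiffer_mul_left, h, peiffer_δ_mul_right]; group

theorem peiffer_δ_mul_left (v : A.L) (e f : A.E) :
    A.peiffer (A.δ v * e) f = v * A.peiffer e f * (A.sec (A.d e • f) v)⁻¹ := by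
  rw [peiffer_mul_left_sec, peiffer_δ_left, sec_δ]; group

theorem peiffer_mul_δ_left (e c : A.E) (k : A.L) :
    A.peiffer (e * A.δ k) c = A.sec e (k * (A.sec c k)⁻¹) * A.peiffer e c := by
  rw [peiffer_mul_left_sec, peiffer_δ_left, A.d_δ, one_smul]

/-- The identity behind the multiplicativity of the second component of a composite homotopy. -/
theorem peiffer_comp_mul (b y f c x : A.E) (v l k l' : A.L) (hc : A.d y • c = f) :
    A.sec y⁻¹ v * A.peiffer y⁻¹ f *
        A.sec c (A.sec (b * y)⁻¹ (A.peiffer b x * l) * k) *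
        A.sec (b * y * A.δ k)⁻¹ (A.peiffer (b * y * A.δ k) c * l') =
      A.sec (b * y)⁻¹ (A.peiffer b (A.δ v * f * x) * A.d b • v * A.sec (A.d b • f) l * l') * k := by
  have hc' : A.d y⁻¹ • f = c := by rw [← hc, smul_smul, map_inv, inv_mul_cancel, one_smul]
  set M := A.peiffer b x * l with hM
  have e1 : A.peiffer b (A.δ v * f * x) * A.d b • v * A.sec (A.d b • f) l =
      A.sec b v * A.sec (b * f * b⁻¹) M * A.peiffer b f := by
    rw [mul_assoc (A.δ v), peiffer_δ_mul_right, peiffer_mul_right_sec, mul_assoc (A.sec b v) (A.sec _ M),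
      ← peiffer_mul_sec, hM, sec_mul_right]
    simp only [mul_assoc, inv_mul_cancel_left]
  -- Split `b` as `(b * y) * y⁻¹`, so that the liftings by `y⁻¹` and by `b * y` on the left-hand
  -- side appear.
  have e2 : A.peiffer b f =
      A.sec (b * y) (A.peiffer y⁻¹ f) * A.peiffer (b * y) c := by
    have h := A.peiffer_mul_left_sec (b * y) y⁻¹ f
    rwa [mul_inv_cancel_right, hc'] at h
  have e3 := A.peiffer_mul_sec y⁻¹ f (A.sec (b * y)⁻¹ M)
  rw [hc', ← sec_mul_left] at e3
  rw [e1, e2, peiffer_mul_δ_left, mul_inv_rev (b * y), sec_mul_left A (A.δ k)⁻¹, sec_δ_inv,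
    sec_mul_right A c, ← sec_mul_left A c]
  calc _ = A.sec y⁻¹ v * (A.peiffer y⁻¹ f * A.sec (c * (b * y)⁻¹) M) * A.sec c k *
        k⁻¹ * (k * (A.sec c k)⁻¹ * A.sec (b * y)⁻¹ (A.peiffer (b * y) c) *
          A.sec (b * y)⁻¹ l') * k := by
        simp only [sec_mul_right A (b * y)⁻¹, sec_inv_sec, mul_assoc]
    _ = _ := by
        rw [e3]
        simp only [sec_mul_right, ← sec_mul_left, mul_inv_rev, inv_inv, mul_assoc,
          inv_mul_cancel_left, mul_inv_cancel_left, inv_mul_cancel, mul_one, sec_one]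

end Peiffer
end TwoCrossedModule

namespace TwoCrossedModule

/-! ### Generators and relations of the triangle group. -/

section Triangle

variable (A : TwoCrossedModule.{uL, uE, uG})

theorem secAut_symm_apply (e : A.E) (l : A.L) : (A.secAut e).symm l = A.sec e⁻¹ l := rfl

theorem liftedAut_symm_apply (p : A.PathGroup) (y : A.SecGroup) :
    (A.liftedAut p).symm y = A.liftedFun p⁻¹ y := rfl

/-- The face of a triangle opposite to its middle vertex. -/
def triangleComposite : A.TriangleGroup →* A.PathGroup where
  toFun t := ⟨t.fst.fst, t.fst.snd * t.snd.fst⟩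
  map_one' := by ext <;> simp
  map_mul' t t' := by
    ext
    · simp
    · simp [liftedAut_symm_apply, liftedFun, mul_assoc, smul_mul']

/-- The second edge of a triangle. -/
def triangleTarget : A.TriangleGroup →* A.PathGroup where
  toFun t := ⟨t.fst.fst * A.d t.fst.snd, t.snd.fst * A.δ t.snd.snd⟩
  map_one' := by ext <;> simp
  map_mul' t t' := by
    ext
    · simp [A.d_smul, mul_assoc]
    · have h : (A.d t'.fst.snd)⁻¹ * t'.fst.fst⁻¹ =
          t'.fst.fst⁻¹ * (A.d (t'.fst.fst • t'.fst.snd))⁻¹ := by rw [A.d_smul]; group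
      simp [liftedAut_symm_apply, liftedFun, mul_assoc, smul_mul', secAut_symm_apply, δ_sec,
        A.δ_peiffer, A.δ_smul, h, mul_smul]

/-- The inclusion of `G` in the triangle group. -/
def triG : A.G →* A.TriangleGroup where
  toFun g := ⟨⟨g, 1⟩, 1⟩
  map_one' := rfl
  map_mul' g h := by ext <;> simp

/-- The inclusion of `E` in the triangle group as the first edges. -/
def triFst : A.E →* A.TriangleGroup where
  toFun e := ⟨⟨1, e⟩, 1⟩
  map_one' := rfl
  map_mul' g h := by ext <;> simp

/-- The inclusion of `E` in the triangle group as the second edges. -/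
def triSnd : A.E →* A.TriangleGroup where
  toFun e := ⟨1, ⟨e, 1⟩⟩
  map_one' := rfl
  map_mul' g h := by ext <;> simp

/-- The inclusion of `L` in the triangle group. -/
def triL : A.L →* A.TriangleGroup where
  toFun l := ⟨1, ⟨1, l⟩⟩
  map_one' := rfl
  map_mul' g h := by ext <;> simp

theorem triL_injective : Function.Injective A.triL := fun _ _ h =>
  congrArg (fun t : A.TriangleGroup => t.snd.snd) h

theorem tri_eq (t : A.TriangleGroup) :
    t = A.triG t.fst.fst * A.triFst t.fst.snd * A.triSnd t.snd.fst * A.triL t.snd.snd := by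
  ext <;> simp [triG, triFst, triSnd, triL]

theorem triFst_smul (g : A.G) (e : A.E) :
    A.triFst (g • e) = A.triG g * A.triFst e * (A.triG g)⁻¹ := by
  rw [eq_mul_inv_iff_mul_eq]
  ext <;> simp [triG, triFst]

theorem triSnd_smul (g : A.G) (e : A.E) :
    A.triSnd (g • e) = A.triG g * A.triSnd e * (A.triG g)⁻¹ := by
  rw [eq_mul_inv_iff_mul_eq]
  ext <;> simp [triG, triSnd, liftedAut_symm_apply, liftedFun, peiffer_one_left]

theorem triL_smul (g : A.G) (l : A.L) :
    A.triL (g • l) = A.triG g * A.triL l * (A.triG g)⁻¹ := by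
  rw [eq_mul_inv_iff_mul_eq]
  ext <;> simp [triG, triL, liftedAut_symm_apply, liftedFun, peiffer_one_left]

/-- The second copy of `E` acts on `L` by the secondary action, the first copy through `d` and the
primary one (`triL_d_smul`). Having two copies is what turns both actions into conjugation in one
group. -/
theorem triL_sec (e : A.E) (l : A.L) :
    A.triL (A.sec e l) = A.triSnd e * A.triL l * (A.triSnd e)⁻¹ := by
  rw [eq_mul_inv_iff_mul_eq]
  ext <;> simp [triSnd, triL, secAut_symm_apply, sec_inv_sec]

theorem triL_d_smul (e : A.E) (l : A.L) :
    A.triL (A.d e • l) = A.triFst e * A.triL l * (A.triFst e)⁻¹ := by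
  rw [eq_mul_inv_iff_mul_eq]
  ext <;> simp [triFst, triL, liftedAut_symm_apply, liftedFun, peiffer_one_right]

/-- The lifting is the obstruction to conjugating the second copy by the first naively. With this
relation every formula in `L` becomes a word in the triangle group. -/
theorem triL_peiffer (x e : A.E) :
    A.triL (A.peiffer x e) =
      A.triSnd (x * e * x⁻¹) * A.triFst x * (A.triSnd e)⁻¹ * (A.triFst x)⁻¹ := by
  rw [eq_mul_inv_iff_mul_eq, eq_mul_inv_iff_mul_eq]
  ext
  · simp [triL, triFst, triSnd]
  · simp [triL, triFst, triSnd]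
  · simp [triL, triFst, triSnd, liftedAut_symm_apply, liftedFun, mul_assoc]
  · simp [triL, triFst, triSnd, liftedAut_symm_apply, liftedFun, secAut_symm_apply,
      peiffer_one_right]
    -- Liftings of inverses come from expanding `{x⁻¹ * x, e⁻¹} = 1` and `{x, e * e⁻¹} = 1`.
    have h1 := A.peiffer_mul_left x⁻¹ x e⁻¹
    have h2 := A.peiffer_mul_right_sec x e e⁻¹
    rw [inv_mul_cancel, peiffer_one_left, eq_comm, mul_eq_one_iff_eq_inv] at h1
    rw [mul_inv_cancel, peiffer_one_right, eq_comm, mul_eq_one_iff_inv_eq] at h2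
    have h3 := congrArg (A.sec (A.d x • e)⁻¹) h2
    rw [sec_inv_sec, sec_inv] at h3
    rw [← mul_assoc x, h1, ← h3, smul_inv', inv_inv, smul_sec, smul_inv', smul_smul, map_inv,
      inv_mul_cancel, one_smul]

/-- The elements `(δ l)⁻¹ l` of the triangle group, which form the kernel of the projection to the
second edge. -/
def triKer (l : A.L) : A.TriangleGroup := (A.triSnd (A.δ l))⁻¹ * A.triL l

/-- By `sec_δ`, the element `δ l` of the second copy conjugates `L` exactly as `l` does, so the
quotient of the two centralises `L`. -/
theorem triKer_commute (l k : A.L) : Commute (A.triKer l) (A.triL k) := by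
  have h := A.triL_sec (A.δ l) k
  rw [sec_δ, map_mul, map_mul, map_inv] at h
  rw [Commute, SemiconjBy, triKer]
  calc _ = (A.triSnd (A.δ l))⁻¹ * (A.triL l * A.triL k * (A.triL l)⁻¹) * A.triL l := by group
    _ = _ := by rw [h]; group

theorem triL_commute_triSnd_δ (l : A.L) : Commute (A.triL l) (A.triSnd (A.δ l)) := by
  have h := A.triL_sec (A.δ l) l
  rw [sec_δ, mul_inv_cancel_right, eq_mul_inv_iff_mul_eq] at h
  exact h

theorem triKer_inv (l : A.L) : A.triKer l⁻¹ = (A.triKer l)⁻¹ := by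
  rw [triKer, triKer, map_inv, map_inv, map_inv, inv_inv, mul_inv_rev, inv_inv]
  exact (A.triL_commute_triSnd_δ l).inv_left.eq.symm

theorem triSnd_mul_triKer (e : A.E) (l : A.L) :
    A.triSnd e * A.triKer l = A.triKer (A.sec e l) * A.triSnd e := by
  rw [triKer, triKer, δ_sec, triL_sec]
  simp only [map_mul, map_inv]; group

/-- On kernel elements both copies of `E` act alike: the discrepancy between the two actions on `l`
is `{e, δ l}`, which `triL_peiffer` cancels against the discrepancy on `δ l`. -/
theorem triFst_mul_triKer (e : A.E) (l : A.L) :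
    A.triFst e * A.triKer l = A.triKer (A.sec e l) * A.triFst e := by
  have h := A.triL_peiffer e (A.δ l)
  rw [peiffer_δ_right, map_mul, map_inv, triL_d_smul, triL_sec] at h
  rw [triKer, triKer, δ_sec, triL_sec]
  calc _ = (A.triSnd (e * A.δ l * e⁻¹))⁻¹ * (A.triSnd (e * A.δ l * e⁻¹) * A.triFst e *
        (A.triSnd (A.δ l))⁻¹ * (A.triFst e)⁻¹) * A.triFst e * A.triL l := by group
    _ = _ := by rw [← h]; group

/-- Equivalently, `triKer l * triFst (δ l)` commutes with the second copy of `E`. This is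
`triL_peiffer` with a boundary as first argument, where the lifting is `l (e ▷' l)⁻¹`. -/
theorem triFst_δ_mul_triSnd (l : A.L) (e : A.E) :
    A.triFst (A.δ l) * A.triSnd e = (A.triKer l)⁻¹ * A.triSnd e * A.triKer l * A.triFst (A.δ l) := by
  have h := A.triL_peiffer (A.δ l) e
  have h2 := A.triKer_commute l (A.sec e l)
  rw [peiffer_δ_left, map_mul, map_inv, triL_sec, map_mul, map_mul, map_inv] at h
  rw [triL_sec] at h2
  have h3 := (A.triL_commute_triSnd_δ l).inv_right.eq
  calc _ = (A.triSnd (A.δ l) * (A.triSnd e)⁻¹ * (A.triSnd (A.δ l))⁻¹ * (A.triSnd (A.δ l) *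
        A.triSnd e * (A.triSnd (A.δ l))⁻¹ * A.triFst (A.δ l) * (A.triSnd e)⁻¹ *
        (A.triFst (A.δ l))⁻¹))⁻¹ * A.triFst (A.δ l) := by group
    _ = (A.triSnd e * A.triL l * (A.triSnd e)⁻¹) * (A.triKer l)⁻¹ * A.triSnd e *
        (A.triSnd (A.δ l))⁻¹ * A.triFst (A.δ l) := by rw [← h, triKer]; group
    _ = (A.triKer l)⁻¹ * (A.triSnd e * (A.triL l * (A.triSnd (A.δ l))⁻¹)) *
        A.triFst (A.δ l) := by rw [← h2.inv_left.eq]; group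
    _ = _ := by rw [h3, triKer]; group

/-- Together with `exists_triKer`, this recognises a long word as an element of `L` or of the kernel
by computing two faces, without determining its last component. -/
theorem exists_triL {t : A.TriangleGroup} (h1 : t.fst = 1) (h2 : A.triangleComposite t = 1) :
    ∃ l, t = A.triL l := by
  refine ⟨t.snd.snd, ?_⟩
  have h3 := congrArg LeftSemidirect.snd h2
  simp only [triangleComposite, MonoidHom.coe_mk, OneHom.coe_mk, h1, LeftSemidirect.one_snd,
    one_mul] at h3
  ext <;> simp [triL, h1, h3]

theorem exists_triKer {t : A.TriangleGroup} (h1 : t.fst = 1) (h2 : A.triangleTarget t = 1) :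
    ∃ l, t = A.triKer l := by
  refine ⟨t.snd.snd, ?_⟩
  have h3 := congrArg LeftSemidirect.snd h2
  simp only [triangleTarget, MonoidHom.coe_mk, OneHom.coe_mk, LeftSemidirect.one_snd] at h3
  rw [triKer, ← map_inv, ← eq_inv_of_mul_eq_one_left h3]
  ext <;> simp [triL, triSnd, h1]

theorem triFst_δ_mul_triL (l k : A.L) :
    A.triFst (A.δ l) * A.triL k = A.triL k * A.triFst (A.δ l) := by
  rw [← mul_inv_eq_iff_eq_mul, ← triL_d_smul, A.d_δ, one_smul]

/-- The normal subgroup `E ⋉ L` of the triangle group. -/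
def triSec : A.SecGroup →* A.TriangleGroup where
  toFun m := ⟨1, m⟩
  map_one' := rfl
  map_mul' g h := by ext <;> simp

theorem triSec_eq (m : A.SecGroup) : A.triSec m = A.triSnd m.fst * A.triL m.snd := by
  ext <;> simp [triSec, triSnd, triL]

theorem exists_triSec {t : A.TriangleGroup} (h1 : t.fst = 1) : ∃ m, t = A.triSec m :=
  ⟨t.snd, by ext <;> simp [triSec, h1]⟩

theorem triFst_δ_mul_triSec (l : A.L) (m : A.SecGroup) :
    A.triFst (A.δ l) * A.triSec m =
      (A.triKer l)⁻¹ * A.triSec m * A.triKer l * A.triFst (A.δ l) := by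
  rw [triSec_eq, ← mul_assoc, triFst_δ_mul_triSnd, mul_assoc _ (A.triFst _), triFst_δ_mul_triL]
  have h := (A.triKer_commute l m.snd).eq
  calc _ = (A.triKer l)⁻¹ * A.triSnd m.fst * (A.triKer l * A.triL m.snd) *
      A.triFst (A.δ l) := by group
    _ = _ := by rw [h]; group

/-- Trades a boundary in the first copy of `E` for a kernel element. -/
theorem triFst_δ_conj {t : A.TriangleGroup} (h : t.fst = 1) (l : A.L) :
    A.triFst (A.δ l) * t * (A.triFst (A.δ l))⁻¹ = (A.triKer l)⁻¹ * t * A.triKer l := by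
  obtain ⟨m, rfl⟩ := A.exists_triSec h
  rw [triFst_δ_mul_triSec, mul_inv_cancel_right]

theorem triFst_δ_inv_conj {t : A.TriangleGroup} (h : t.fst = 1) (l : A.L) :
    (A.triFst (A.δ l))⁻¹ * t * A.triFst (A.δ l) = A.triKer l * t * (A.triKer l)⁻¹ := by
  have h := A.triFst_δ_conj h l⁻¹
  rwa [map_inv, map_inv, inv_inv, triKer_inv, inv_inv] at h

end Triangle
end TwoCrossedModule

namespace TwoCrossedModule

/-! ### Equivariance of a composite, as an equality of words. -/

section DerivAct

variable (A : TwoCrossedModule.{uL, uE, uG})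

/-- The expression governing the equivariance of the second component of a quadratic derivation. -/
def derivAct (a y x : A.E) (l : A.L) : A.L :=
  A.sec (y * x⁻¹) (A.peiffer a⁻¹ y⁻¹)⁻¹ * A.peiffer y (x⁻¹ * a⁻¹) * A.d y • l

/-- Apart from a prefix, the value is the conjugate by `triFst y` of the single word `a * x * l`, a
lift of the target value `ψ' = a x δ(l)`; this is what makes iteration tractable. -/
theorem triL_derivAct (a y x : A.E) (l : A.L) :
    A.triL (A.derivAct a y x l) =
      A.triSnd y * (A.triSnd x)⁻¹ * (A.triFst a)⁻¹ * (A.triSnd y)⁻¹ * A.triFst a *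
        (A.triSnd a)⁻¹ * A.triFst y * (A.triSnd a * A.triSnd x * A.triL l) * (A.triFst y)⁻¹ := by
  simp only [derivAct, map_mul, triL_sec, triL_d_smul, map_inv, triL_peiffer]
  group

/-- The first copy of `a` and the element `d a` of `G` act identically on `L`. -/
theorem triG_commute_triL (a : A.E) (l : A.L) :
    Commute (A.triG (A.d a) * (A.triFst a)⁻¹) (A.triL l) := by
  have h := A.triL_smul (A.d a)⁻¹ l
  rw [← map_inv, triL_d_smul, map_inv, map_inv, map_inv, inv_inv, inv_inv] at h
  calc _ = A.triG (A.d a) * ((A.triFst a)⁻¹ * A.triL l * A.triFst a) * (A.triFst a)⁻¹ := by group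
    _ = _ := by rw [h]; group

theorem triFst_inv_mul_triKer (e : A.E) (l : A.L) :
    (A.triFst e)⁻¹ * A.triKer l = A.triKer (A.sec e⁻¹ l) * (A.triFst e)⁻¹ := by
  rw [← map_inv, triFst_mul_triKer]

theorem triSnd_inv_mul_triKer (e : A.E) (l : A.L) :
    (A.triSnd e)⁻¹ * A.triKer l = A.triKer (A.sec e⁻¹ l) * (A.triSnd e)⁻¹ := by
  rw [← map_inv, triSnd_mul_triKer]

theorem triSnd_inv_triFst_commute (e : A.E) (l : A.L) :
    Commute (A.triKer l) ((A.triSnd e)⁻¹ * A.triFst e) := by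
  rw [Commute, SemiconjBy, mul_assoc _ (A.triFst e), triFst_mul_triKer, ← mul_assoc _ (A.triKer _),
    triSnd_inv_mul_triKer, sec_inv_sec, mul_assoc]

theorem triFst_fst (e : A.E) : (A.triFst e).fst = ⟨1, e⟩ := rfl
theorem triSnd_fst (e : A.E) : (A.triSnd e).fst = 1 := rfl
theorem triL_fst (e : A.L) : (A.triL e).fst = 1 := rfl
theorem triG_fst (e : A.G) : (A.triG e).fst = ⟨e, 1⟩ := rfl
theorem triKer_fst (e : A.L) : (A.triKer e).fst = 1 := by simp [triKer, triSnd_fst, triL_fst]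

theorem triangleComposite_triFst (e : A.E) : A.triangleComposite (A.triFst e) = ⟨1, e⟩ := by
  ext <;> simp [triangleComposite, triFst]
theorem triangleComposite_triSnd (e : A.E) : A.triangleComposite (A.triSnd e) = ⟨1, e⟩ := by
  ext <;> simp [triangleComposite, triSnd]
theorem triangleComposite_triL (e : A.L) : A.triangleComposite (A.triL e) = 1 := by
  ext <;> simp [triangleComposite, triL]
theorem triangleComposite_triG (e : A.G) : A.triangleComposite (A.triG e) = ⟨e, 1⟩ := by
  ext <;> simp [triangleComposite, triG]
theorem triangleComposite_triKer (e : A.L) :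
    A.triangleComposite (A.triKer e) = ⟨1, (A.δ e)⁻¹⟩ := by
  rw [triKer, map_mul, map_inv, triangleComposite_triSnd, triangleComposite_triL]
  ext <;> simp
theorem triangleTarget_triFst (e : A.E) : A.triangleTarget (A.triFst e) = ⟨A.d e, 1⟩ := by
  ext <;> simp [triangleTarget, triFst]
theorem triangleTarget_triSnd (e : A.E) : A.triangleTarget (A.triSnd e) = ⟨1, e⟩ := by
  ext <;> simp [triangleTarget, triSnd]
theorem triangleTarget_triL (e : A.L) : A.triangleTarget (A.triL e) = ⟨1, A.δ e⟩ := by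
  ext <;> simp [triangleTarget, triL]
theorem triangleTarget_triG (e : A.G) : A.triangleTarget (A.triG e) = ⟨e, 1⟩ := by
  ext <;> simp [triangleTarget, triG]
theorem triangleTarget_triKer (e : A.L) : A.triangleTarget (A.triKer e) = 1 := by
  rw [triKer, map_mul, map_inv, triangleTarget_triSnd, triangleTarget_triL]
  ext <;> simp

/-- The defect of commutativity between the two inclusions of `E`. -/
theorem exists_triL_comm (a x y : A.E) (l : A.L) :
    ∃ i, (A.triFst x)⁻¹ * (A.triFst a)⁻¹ * (A.triSnd y)⁻¹ * A.triFst a * A.triFst x *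
      (A.triSnd a * A.triSnd x * A.triL l)⁻¹ * A.triFst y * (A.triSnd a * A.triSnd x * A.triL l) =
      A.triL i * ((A.triSnd y)⁻¹ * A.triFst y) := by
  obtain ⟨i, hi⟩ := A.exists_triL (t := (A.triFst x)⁻¹ * (A.triFst a)⁻¹ * (A.triSnd y)⁻¹ *
      A.triFst a * A.triFst x * (A.triSnd a * A.triSnd x * A.triL l)⁻¹ * A.triFst y *
      (A.triSnd a * A.triSnd x * A.triL l) * ((A.triSnd y)⁻¹ * A.triFst y)⁻¹)
    (by
      ext <;> simp [triFst_fst, triSnd_fst, triL_fst, mul_assoc])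
    (by
      ext <;> simp [triangleComposite_triFst, triangleComposite_triSnd, triangleComposite_triL,
        mul_assoc])
  exact ⟨i, by rw [← hi, inv_mul_cancel_right]⟩

theorem exists_triKer_comm (a y : A.E) (z : A.L) :
    ∃ i, (A.triG (A.d a))⁻¹ * A.triSnd y * A.triKer z * A.triG (A.d a) * (A.triFst a)⁻¹ *
      (A.triKer z)⁻¹ * (A.triSnd y)⁻¹ * A.triFst a = A.triKer i := by
  apply A.exists_triKer
  · ext <;> simp [triFst_fst, triSnd_fst, triG_fst, triKer_fst, mul_assoc]
  · ext <;> simp [triangleTarget_triFst, triangleTarget_triSnd, triangleTarget_triKer,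
      triangleTarget_triG, mul_assoc]

/-- The expression for the target homotopy only depends on lifts to the triangle group. -/
theorem triL_derivAct_target (a x y : A.E) (l l' : A.L) (x' : A.E) :
    A.triL (A.derivAct (a * x * A.δ l) y x' l') =
      A.triSnd y * (A.triSnd x')⁻¹ * ((A.triFst x)⁻¹ * (A.triFst a)⁻¹ * (A.triSnd y)⁻¹ *
        A.triFst a * A.triFst x * (A.triSnd a * A.triSnd x * A.triL l)⁻¹ * A.triFst y *
        (A.triSnd a * A.triSnd x * A.triL l)) * A.triSnd x' * A.triL l' * (A.triFst y)⁻¹ := by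
  -- The factor `δ l` contributes `triKer l` in both copies of `E`. Altogether the word is
  -- conjugated by `triKer l`, which commutes with it by `h3`.
  have h1 : A.triSnd (a * x * A.δ l) = A.triSnd a * A.triSnd x * A.triL l * (A.triKer l)⁻¹ := by
    rw [triKer]; simp only [map_mul]; group
  have h2 : (A.triFst (a * x * A.δ l))⁻¹ * (A.triSnd y)⁻¹ * A.triFst (a * x * A.δ l) =
      A.triKer l * ((A.triFst x)⁻¹ * (A.triFst a)⁻¹ * (A.triSnd y)⁻¹ * A.triFst a *
        A.triFst x) * (A.triKer l)⁻¹ := by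
    rw [← triFst_δ_inv_conj]
    · simp only [map_mul]; group
    · ext <;> simp [triFst_fst, triSnd_fst, mul_assoc]
  obtain ⟨i, hi⟩ := A.exists_triL_comm a x y l
  have h3 : A.triKer l * ((A.triFst x)⁻¹ * (A.triFst a)⁻¹ * (A.triSnd y)⁻¹ * A.triFst a *
      A.triFst x * (A.triSnd a * A.triSnd x * A.triL l)⁻¹ * A.triFst y *
      (A.triSnd a * A.triSnd x * A.triL l)) * (A.triKer l)⁻¹ = A.triL i *
        ((A.triSnd y)⁻¹ * A.triFst y) := by
    rw [hi, ((A.triKer_commute l i).mul_right (A.triSnd_inv_triFst_commute y l)).eq,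
      mul_inv_cancel_right]
  rw [triL_derivAct, hi, ← h3]
  calc _ = A.triSnd y * (A.triSnd x')⁻¹ * ((A.triFst (a * x * A.δ l))⁻¹ * (A.triSnd y)⁻¹ *
        A.triFst (a * x * A.δ l)) * (A.triSnd (a * x * A.δ l))⁻¹ * A.triFst y *
        A.triSnd (a * x * A.δ l) * A.triSnd x' * A.triL l' * (A.triFst y)⁻¹ := by group
    _ = _ := by rw [h2, h1]; group

/-- By `exists_triL_comm` the inner word is an element of `L` times the quotient of the two copies
of `y'`, and both centralise all kernel elements. -/
theorem triKer_commute_target (a x y' x' : A.E) (l l' k : A.L) :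
    Commute (A.triKer k) ((A.triSnd x')⁻¹ * ((A.triFst x)⁻¹ * (A.triFst a)⁻¹ * (A.triSnd y')⁻¹ *
        A.triFst a * A.triFst x * (A.triSnd a * A.triSnd x * A.triL l)⁻¹ * A.triFst y' *
        (A.triSnd a * A.triSnd x * A.triL l)) * A.triSnd x' *
      A.triL l') := by
  obtain ⟨i, hi⟩ := A.exists_triL_comm a x y' l
  have h1 : Commute (A.triKer (A.sec x' k)) (A.triL i * ((A.triSnd y')⁻¹ * A.triFst y')) :=
    (A.triKer_commute _ i).mul_right (A.triSnd_inv_triFst_commute y' _)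
  have h2 := A.triSnd_mul_triKer x' k
  rw [hi]
  refine Commute.mul_right ?_ (A.triKer_commute _ _)
  calc _ = (A.triSnd x')⁻¹ * (A.triSnd x' * A.triKer k) * (A.triSnd x')⁻¹ * (A.triL i *
      ((A.triSnd y')⁻¹ * A.triFst y')) * A.triSnd x' := by group
    _ = (A.triSnd x')⁻¹ * (A.triKer (A.sec x' k) * (A.triL i * ((A.triSnd y')⁻¹ *
        A.triFst y'))) * A.triSnd x' := by rw [h2]; group
    _ = (A.triSnd x')⁻¹ * (A.triL i * ((A.triSnd y')⁻¹ * A.triFst y')) * (A.triKer (A.sec x' k) *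
        A.triSnd x') := by rw [h1.eq]; group
    _ = _ := by rw [← h2]; group

/-- The two copies of `x` cancel in their effect on kernel elements and `L` has none, so only `a`
acts. -/
theorem triSnd_mul_triFst_inv_mul_triKer (a x : A.E) (l q : A.L) :
    (A.triSnd a * A.triSnd x * A.triL l) * (A.triFst x)⁻¹ * A.triKer q = A.triKer (A.sec a q) *
        ((A.triSnd a * A.triSnd x * A.triL l) * (A.triFst x)⁻¹) := by
  calc _ = A.triSnd a * A.triSnd x * A.triL l * ((A.triFst x)⁻¹ * A.triKer q) := by group
    _ = A.triSnd a * (A.triSnd x * (A.triL l * A.triKer (A.sec x⁻¹ q))) * (A.triFst x)⁻¹ := by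
      rw [triFst_inv_mul_triKer]; group
    _ = A.triSnd a * (A.triSnd x * A.triKer (A.sec x⁻¹ q)) * A.triL l * (A.triFst x)⁻¹ := by
      rw [← (A.triKer_commute _ l).eq]; group
    _ = A.triSnd a * A.triKer q * A.triSnd x * A.triL l * (A.triFst x)⁻¹ := by
      rw [triSnd_mul_triKer, sec_sec_inv]; group
    _ = _ := by rw [triSnd_mul_triKer]; group

/-- The inner bracket is a kernel element `β` times an explicit one. Both are carried through the
word by the secondary action, and the value of `β` is never needed since it is expanded again at the
end. -/
theorem triKer_exchange (a x y y' : A.E) (l z : A.L) :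
    (A.triG (A.d a))⁻¹ * A.triSnd y * A.triG (A.d a) * (A.triFst a)⁻¹ * (A.triSnd y)⁻¹ *
        A.triFst a * (A.triSnd a)⁻¹ * A.triFst y * (A.triSnd a * A.triSnd x * A.triL l) *
        (A.triFst x)⁻¹ *
        ((A.triG (A.d a))⁻¹ * A.triSnd y' * A.triKer z * A.triG (A.d a) * (A.triFst a)⁻¹ *
            (A.triSnd y')⁻¹ * A.triFst a) * A.triFst x * (A.triSnd a * A.triSnd x * A.triL l)⁻¹ *
            A.triFst y' =
      (A.triG (A.d a))⁻¹ * A.triSnd y * A.triSnd y' * A.triKer z * A.triG (A.d a) *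
          (A.triFst a)⁻¹ * (A.triKer z)⁻¹ * (A.triSnd y')⁻¹ * (A.triSnd y)⁻¹ * A.triFst a *
          (A.triSnd a)⁻¹ * A.triFst y * A.triFst y' * A.triKer z := by
  obtain ⟨β, hβ⟩ := A.exists_triKer_comm a y' z
  have hPx := A.triSnd_mul_triFst_inv_mul_triKer a x l
  have h1 : (A.triG (A.d a))⁻¹ * A.triSnd y' * A.triKer z * A.triG (A.d a) * (A.triFst a)⁻¹ *
      (A.triSnd y')⁻¹ * A.triFst a =
      A.triKer β * A.triKer (A.sec a⁻¹ (A.sec y' z)) := by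
    have h : (A.triFst a)⁻¹ * (A.triSnd y' * A.triKer z) = A.triKer (A.sec a⁻¹ (A.sec y' z)) *
        (A.triFst a)⁻¹ * A.triSnd y' := by
      rw [triSnd_mul_triKer, ← mul_assoc, triFst_inv_mul_triKer]
    calc _ = (A.triG (A.d a))⁻¹ * A.triSnd y' * A.triKer z * A.triG (A.d a) * (A.triFst a)⁻¹ *
        (A.triKer z)⁻¹ * (A.triSnd y')⁻¹ * A.triFst a * ((A.triFst a)⁻¹ * (A.triSnd y' *
        A.triKer z)) * (A.triSnd y')⁻¹ * A.triFst a := by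
          group
      _ = _ := by rw [hβ, h]; group
  have h2 : ∀ q, (A.triSnd a)⁻¹ * A.triFst y * A.triKer q = A.triKer (A.sec a⁻¹ (A.sec y q)) *
      ((A.triSnd a)⁻¹ * A.triFst y) := by
    intro q
    rw [mul_assoc, triFst_mul_triKer, ← mul_assoc, triSnd_inv_mul_triKer, mul_assoc]
  have h3 : ((A.triFst a)⁻¹ * (A.triSnd y)⁻¹ * A.triFst a) *
      A.triKer (A.sec a⁻¹ (A.sec y (A.sec a β))) =
      A.triKer β * ((A.triFst a)⁻¹ * (A.triSnd y)⁻¹ * A.triFst a) := by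
    rw [mul_assoc, triFst_mul_triKer, sec_sec_inv, mul_assoc, ← mul_assoc (A.triSnd y)⁻¹,
      triSnd_inv_mul_triKer, sec_inv_sec, ← mul_assoc, ← mul_assoc, triFst_inv_mul_triKer,
      sec_inv_sec]
    simp only [mul_assoc]
  have h4 : A.triFst y' * A.triKer z = A.triKer (A.sec y' z) *
      A.triFst y' := A.triFst_mul_triKer _ _
  calc _ = (A.triG (A.d a))⁻¹ * A.triSnd y * A.triG (A.d a) * (A.triFst a)⁻¹ * (A.triSnd y)⁻¹ *
      A.triFst a * ((A.triSnd a)⁻¹ * A.triFst y * ((A.triSnd a * A.triSnd x * A.triL l) *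
      (A.triFst x)⁻¹ *
        A.triKer β) * A.triKer (A.sec a⁻¹ (A.sec y' z))) * A.triFst x * (A.triSnd a *
            A.triSnd x * A.triL l)⁻¹ * A.triFst y' := by
        rw [h1]; group
    _ = (A.triG (A.d a))⁻¹ * A.triSnd y * A.triG (A.d a) * (A.triFst a)⁻¹ * (A.triSnd y)⁻¹ *
        A.triFst a * (((A.triSnd a)⁻¹ * A.triFst y * A.triKer (A.sec a β)) *
        ((A.triSnd a * A.triSnd x * A.triL l) * (A.triFst x)⁻¹ *
            A.triKer (A.sec a⁻¹ (A.sec y' z)))) * A.triFst x * (A.triSnd a * A.triSnd x *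
            A.triL l)⁻¹ * A.triFst y' := by
        rw [hPx]; group
    _ = (A.triG (A.d a))⁻¹ * A.triSnd y * A.triG (A.d a) * ((A.triFst a)⁻¹ * (A.triSnd y)⁻¹ *
        A.triFst a * A.triKer (A.sec a⁻¹ (A.sec y (A.sec a β)))) *
        ((A.triSnd a)⁻¹ * A.triFst y * A.triKer (A.sec y' z)) * A.triFst y' := by
        rw [hPx, h2, sec_sec_inv]; group
    _ = (A.triG (A.d a))⁻¹ * A.triSnd y * A.triG (A.d a) * A.triKer β * ((A.triFst a)⁻¹ *
        (A.triSnd y)⁻¹ * A.triFst a) * (A.triSnd a)⁻¹ * A.triFst y * (A.triFst y' *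
        A.triKer z) := by
        rw [h3, h4]; group
    _ = _ := by rw [← hβ]; group

/-- This is the composite face of `hv`, on which `triKer z` becomes `(δ z)⁻¹`. -/
theorem triSnd_of_triangle_eq {a y x y' x' r' : A.E} {z w v : A.L}
    (hv : A.triG (A.d a) * A.triFst ((A.d a)⁻¹ • y * x * y⁻¹) * A.triSnd r' * A.triKer v =
      (A.triFst y * A.triSnd y' * A.triKer z) * (A.triG (A.d a) * A.triFst x * A.triSnd x' *
          A.triKer w) * (A.triFst y * A.triSnd y' * A.triKer z)⁻¹) :
    ((A.triG (A.d a))⁻¹ * A.triSnd y * A.triG (A.d a) * A.triSnd x * (A.triSnd y)⁻¹) *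
        (A.triSnd r' * (A.triSnd (A.δ v))⁻¹) =
      (A.triG (A.d a))⁻¹ * A.triSnd (y * y' * (A.δ z)⁻¹) * A.triG (A.d a) * A.triSnd (x * x' *
          (A.δ w)⁻¹) *
      (A.triSnd (y * y' * (A.δ z)⁻¹))⁻¹ := by
  have h := congrArg (fun t => A.triSnd (A.triangleComposite t).snd) hv
  simp only [map_mul, map_inv, triangleComposite_triG,
    triangleComposite_triFst, triangleComposite_triSnd, triangleComposite_triKer] at h
  simp only [LeftSemidirect.mul_snd, LeftSemidirect.mul_fst, LeftSemidirect.inv_fst,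
    LeftSemidirect.inv_snd, inv_one, map_one, MulAut.one_apply, mul_one, one_mul,
    MulDistribMulAction.toMulAut_apply,
    triSnd_smul, map_mul, map_inv, inv_inv, mul_inv_rev] at h
  have ht : ∀ e, A.triSnd ((MulDistribMulAction.toMulEquiv A.E (A.d a))⁻¹ e) =
      (A.triG (A.d a))⁻¹ * A.triSnd e * A.triG (A.d a) := by
    intro e
    have h := A.triSnd_smul (A.d a)⁻¹ e
    rwa [map_inv, inv_inv] at h
  simp only [ht, map_mul, map_inv, mul_inv_rev, inv_inv, mul_assoc, mul_inv_cancel_left] at h ⊢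
  exact h

/-- The hypothesis is the conjugation relation for the morphism to the triangle group, with `z`,
`w`, `v` its defects. Both sides become words that differ only in the position of the kernel
elements of `z` and `w`. -/
theorem derivAct_comp {a y x y' x' r' : A.E} {z w v l l' : A.L}
    (hv : A.triG (A.d a) * A.triFst ((A.d a)⁻¹ • y * x * y⁻¹) * A.triSnd r' * A.triKer v =
      (A.triFst y * A.triSnd y' * A.triKer z) * (A.triG (A.d a) * A.triFst x * A.triSnd x' *
          A.triKer w) * (A.triFst y * A.triSnd y' * A.triKer z)⁻¹) :
    v * A.sec r'⁻¹ (A.derivAct a y x l) * A.d y • A.derivAct (a * x * A.δ l) y' x' l' =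
      A.derivAct a (y * y' * (A.δ z)⁻¹) (x * x' * (A.δ w)⁻¹) (w * A.sec x'⁻¹ l * l') := by
  have hτ := A.triL_derivAct a y x l
  have hτ' := A.triL_derivAct_target a x y' l l' x'
  have hRV : A.triSnd r' * A.triKer v = A.triFst y * (A.triFst x)⁻¹ * (A.triG (A.d a))⁻¹ *
      A.triSnd y' * A.triKer z * A.triG (A.d a) * A.triFst x * A.triSnd x' * A.triKer w *
      (A.triKer z)⁻¹ * (A.triSnd y')⁻¹ * (A.triFst y)⁻¹ := by
    rw [map_mul, map_mul, triFst_smul, map_inv, map_inv] at hv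
    calc _ = (A.triG (A.d a) * ((A.triG (A.d a))⁻¹ * A.triFst y * (A.triG (A.d a))⁻¹⁻¹ *
        A.triFst x * (A.triFst y)⁻¹))⁻¹ *
          (A.triG (A.d a) * ((A.triG (A.d a))⁻¹ * A.triFst y * (A.triG (A.d a))⁻¹⁻¹ *
              A.triFst x * (A.triFst y)⁻¹) * A.triSnd r' * A.triKer v) := by group
      _ = _ := by rw [hv]; group
  have hR := A.triSnd_of_triangle_eq hv
  have hM := (A.triKer_commute v (A.d y • A.derivAct (a * x * A.δ l) y' x' l')).eq
  have hτR := (A.triKer_commute (A.sec r' v) (A.derivAct a y x l)).eq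
  have hRv := A.triSnd_mul_triKer r' v
  have hQ : A.triSnd a * A.triSnd (x * x' * (A.δ w)⁻¹) * A.triL (w * A.sec x'⁻¹ l * l') =
      (A.triSnd a * A.triSnd x * A.triL l) * A.triSnd x' * A.triL l' * A.triKer w := by
    have h1 := (A.triKer_commute (A.sec x' w) l).eq
    have h2 := A.triSnd_mul_triKer x' w
    have h3 := (A.triKer_commute w l').eq
    have h4 : (A.triSnd (A.δ w))⁻¹ * A.triL w = A.triKer w := rfl
    simp only [map_mul, map_inv, triL_sec, inv_inv]
    calc _ = A.triSnd a * A.triSnd x * (A.triSnd x' * ((A.triSnd (A.δ w))⁻¹ * A.triL w)) *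
        (A.triSnd x')⁻¹ * A.triL l * A.triSnd x' *
          A.triL l' := by group
      _ = A.triSnd a * A.triSnd x * (A.triKer (A.sec x' w) * A.triL l) * A.triSnd x' *
          A.triL l' := by
          rw [h4, h2]; group
      _ = A.triSnd a * A.triSnd x * A.triL l * (A.triKer (A.sec x' w) * A.triSnd x') *
          A.triL l' := by
          rw [h1]; group
      _ = A.triSnd a * A.triSnd x * A.triL l * A.triSnd x' * (A.triKer w *
          A.triL l') := by rw [← h2]; group
      _ = _ := by rw [h3]; group
  have hS0 : A.triFst (y * y' * (A.δ z)⁻¹) * ((A.triSnd a * A.triSnd x * A.triL l) *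
      A.triSnd x' * A.triL l' * A.triKer w) *
      (A.triFst (y * y' * (A.δ z)⁻¹))⁻¹ =
      A.triFst y * A.triFst y' * (A.triKer z * ((A.triSnd a * A.triSnd x * A.triL l) *
          A.triSnd x' * A.triL l' * A.triKer w) * (A.triKer z)⁻¹) * (A.triFst y')⁻¹ *
          (A.triFst y)⁻¹ := by
    rw [← triFst_δ_inv_conj]
    · simp only [map_mul, map_inv]; group
    · simp [triSnd_fst, triL_fst, triKer_fst]
  have hS1 : A.triSnd (y * y' * (A.δ z)⁻¹) = A.triSnd y * A.triSnd y' * A.triKer z *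
      (A.triL z)⁻¹ := by
    rw [map_mul, map_mul, map_inv, triKer]; group
  have hz := (A.triG_commute_triL a z).inv_right.eq
  have hfin := A.triKer_exchange a x y y' l z
  have hDz := A.triKer_commute_target a x y' x' l l' z
  have hDw := A.triKer_commute_target a x y' x' l l' w
  apply A.triL_injective
  -- This factor has two expressions by `hR`: the one in `r'` and `v` suits the left-hand side, the
  -- one in the composites suits the right-hand side.
  refine mul_left_cancel (a := ((A.triG (A.d a))⁻¹ * A.triSnd y * A.triG (A.d a) * A.triSnd x *
      (A.triSnd y)⁻¹) * (A.triSnd r' * (A.triSnd (A.δ v))⁻¹)) ?_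
  have hright : ((A.triG (A.d a))⁻¹ * A.triSnd y * A.triG (A.d a) * A.triSnd x *
      (A.triSnd y)⁻¹) * (A.triSnd r' * (A.triSnd (A.δ v))⁻¹) *
      A.triL (A.derivAct a (y * y' * (A.δ z)⁻¹) (x * x' * (A.δ w)⁻¹) (w * A.sec x'⁻¹ l * l')) =
      (A.triG (A.d a))⁻¹ * A.triSnd y * A.triSnd y' * A.triKer z * A.triG (A.d a) *
          (A.triFst a)⁻¹ * (A.triKer z)⁻¹ * (A.triSnd y')⁻¹ * (A.triSnd y)⁻¹ * A.triFst a *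
          (A.triSnd a)⁻¹ * A.triFst y * A.triFst y' * A.triKer z *
        ((A.triSnd a * A.triSnd x * A.triL l) * A.triSnd x' * A.triL l' * A.triKer w) *
            (A.triKer z)⁻¹ * (A.triFst y')⁻¹ * (A.triFst y)⁻¹ := by
    rw [hR, triL_derivAct, hQ]
    calc _ = (A.triG (A.d a))⁻¹ * A.triSnd (y * y' * (A.δ z)⁻¹) * A.triG (A.d a) * (A.triFst a)⁻¹ *
          (A.triSnd (y * y' * (A.δ z)⁻¹))⁻¹ * A.triFst a * (A.triSnd a)⁻¹ *
          (A.triFst (y * y' * (A.δ z)⁻¹) * ((A.triSnd a * A.triSnd x * A.triL l) * A.triSnd x' *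
              A.triL l' * A.triKer w) *
          (A.triFst (y * y' * (A.δ z)⁻¹))⁻¹) := by group
      _ = (A.triG (A.d a))⁻¹ * A.triSnd y * A.triSnd y' * A.triKer z * ((A.triL z)⁻¹ *
          (A.triG (A.d a) * (A.triFst a)⁻¹)) * A.triL z * (A.triKer z)⁻¹ * (A.triSnd y')⁻¹ *
          (A.triSnd y)⁻¹ *
          A.triFst a * (A.triSnd a)⁻¹ * (A.triFst y * A.triFst y' * (A.triKer z * ((A.triSnd a *
              A.triSnd x * A.triL l) * A.triSnd x' * A.triL l' * A.triKer w) * (A.triKer z)⁻¹) *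
              (A.triFst y')⁻¹ * (A.triFst y)⁻¹) := by
          rw [hS0, hS1]; group
      _ = _ := by rw [← hz]; group
  have hleft : ((A.triG (A.d a))⁻¹ * A.triSnd y * A.triG (A.d a) * A.triSnd x * (A.triSnd y)⁻¹) *
      (A.triSnd r' * (A.triSnd (A.δ v))⁻¹) *
      A.triL (v * A.sec r'⁻¹ (A.derivAct a y x l) *
        A.d y • A.derivAct (a * x * A.δ l) y' x' l') =
      (A.triG (A.d a))⁻¹ * A.triSnd y * A.triG (A.d a) * A.triSnd x * (A.triSnd y)⁻¹ *
          A.triL (A.derivAct a y x l) * (A.triSnd r' * A.triKer v) *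
        (A.triFst y * A.triL (A.derivAct (a * x * A.δ l) y' x' l') * (A.triFst y)⁻¹) := by
    have h4 : (A.triSnd (A.δ v))⁻¹ * A.triL v = A.triKer v := rfl
    rw [map_mul, map_mul, triL_sec, map_inv, inv_inv, ← triL_d_smul]
    calc _ = (A.triG (A.d a))⁻¹ * A.triSnd y * A.triG (A.d a) * A.triSnd x * (A.triSnd y)⁻¹ *
        (A.triSnd r' * ((A.triSnd (A.δ v))⁻¹ * A.triL v)) * (A.triSnd r')⁻¹ *
          A.triL (A.derivAct a y x l) * A.triSnd r' *
          A.triL (A.d y • A.derivAct (a * x * A.δ l) y' x' l') := by group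
      _ = (A.triG (A.d a))⁻¹ * A.triSnd y * A.triG (A.d a) * A.triSnd x * (A.triSnd y)⁻¹ *
          (A.triKer (A.sec r' v) *
          A.triL (A.derivAct a y x l)) * A.triSnd r' *
          A.triL (A.d y • A.derivAct (a * x * A.δ l) y' x' l') := by rw [h4, hRv]; group
      _ = (A.triG (A.d a))⁻¹ * A.triSnd y * A.triG (A.d a) * A.triSnd x * (A.triSnd y)⁻¹ *
          A.triL (A.derivAct a y x l) *
          (A.triKer (A.sec r' v) * A.triSnd r') *
          A.triL (A.d y • A.derivAct (a * x * A.δ l) y' x' l') := by rw [hτR]; group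
      _ = _ := by rw [← hRv]
  rw [hleft, hright, hRV, hτ, hτ']
  clear hleft hright hRV hτ hτ' hz hS1 hS0 hQ hRv hτR hM hR hv
  generalize hDD : (A.triFst x)⁻¹ * (A.triFst a)⁻¹ * (A.triSnd y')⁻¹ * A.triFst a * A.triFst x *
      (A.triSnd a * A.triSnd x * A.triL l)⁻¹ * A.triFst y' * (A.triSnd a * A.triSnd x *
      A.triL l) = D at hDz hDw ⊢
  calc _ = (A.triG (A.d a))⁻¹ * A.triSnd y * A.triG (A.d a) * (A.triFst a)⁻¹ * (A.triSnd y)⁻¹ *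
      A.triFst a * (A.triSnd a)⁻¹ * A.triFst y * (A.triSnd a * A.triSnd x * A.triL l) *
      (A.triFst x)⁻¹ * (A.triG (A.d a))⁻¹ * A.triSnd y' * A.triKer z * A.triG (A.d a) *
        A.triFst x * A.triSnd x' * A.triKer w * (A.triKer z)⁻¹ * ((A.triSnd x')⁻¹ * D *
            A.triSnd x' * A.triL l') * (A.triFst y')⁻¹ * (A.triFst y)⁻¹ := by group
    _ = (A.triG (A.d a))⁻¹ * A.triSnd y * A.triG (A.d a) * (A.triFst a)⁻¹ * (A.triSnd y)⁻¹ *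
        A.triFst a * (A.triSnd a)⁻¹ * A.triFst y * (A.triSnd a * A.triSnd x * A.triL l) *
        (A.triFst x)⁻¹ * (A.triG (A.d a))⁻¹ * A.triSnd y' * A.triKer z * A.triG (A.d a) *
        A.triFst x * A.triSnd x' * ((A.triSnd x')⁻¹ * D * A.triSnd x' * A.triL l') * A.triKer w *
            (A.triKer z)⁻¹ * (A.triFst y')⁻¹ * (A.triFst y)⁻¹ := by
        rw [mul_assoc _ (A.triKer z)⁻¹ _, hDz.inv_left.eq, ← mul_assoc,
          mul_assoc _ (A.triKer w) _, hDw.eq, ← mul_assoc]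
    _ = ((A.triG (A.d a))⁻¹ * A.triSnd y * A.triG (A.d a) * (A.triFst a)⁻¹ * (A.triSnd y)⁻¹ *
        A.triFst a * (A.triSnd a)⁻¹ * A.triFst y * (A.triSnd a * A.triSnd x * A.triL l) *
        (A.triFst x)⁻¹ *
        ((A.triG (A.d a))⁻¹ * A.triSnd y' * A.triKer z * A.triG (A.d a) * (A.triFst a)⁻¹ *
            (A.triSnd y')⁻¹ * A.triFst a) * A.triFst x * (A.triSnd a * A.triSnd x * A.triL l)⁻¹ *
            A.triFst y') * (A.triSnd a * A.triSnd x * A.triL l) * A.triSnd x' * A.triL l' *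
            A.triKer w *
        (A.triKer z)⁻¹ * (A.triFst y')⁻¹ * (A.triFst y)⁻¹ := by rw [← hDD]; group
    _ = _ := by rw [hfin]; group

end DerivAct
end TwoCrossedModule

namespace TwoCrossedModule

/-! ### Derivations on free groups and their triangle lifts. -/

section Derivations

variable {F : Type v} [Group F] {A : TwoCrossedModule.{uL, uE, uG}} {ι : Type w}
  (b : FreeGroupBasis ι F)

/-- `s` is a derivation with respect to the morphism `φ`. -/
def IsDerivation (φ : F →* A.G) (s : F → A.E) : Prop :=
  ∀ g h, s (g * h) = (φ h)⁻¹ • s g * s h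

namespace IsDerivation

variable {φ φ' : F →* A.G} {s s' : F → A.E}

/-- The group morphism to the path group corresponding to a derivation. -/
def pathHom (hs : IsDerivation φ s) : F →* A.PathGroup :=
  MonoidHom.mk' (fun g => ⟨φ g, s g⟩) fun g h => by
    ext
    · simp
    · simp [hs g h]

theorem map_one (hs : IsDerivation φ s) : s 1 = 1 :=
  congrArg LeftSemidirect.snd (_root_.map_one hs.pathHom)

theorem smul_conj (hs : IsDerivation φ s) (g m : F) :
    (φ g)⁻¹ • s (g * m * g⁻¹) = (φ m)⁻¹ • s g * s m * (s g)⁻¹ := by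
  have h := hs (g * m * g⁻¹) g
  rw [inv_mul_cancel_right, hs] at h
  rw [h, mul_inv_cancel_right]

theorem ext_basis (hs : IsDerivation φ s) (hs' : IsDerivation φ s')
    (h : ∀ i, s (b i) = s' (b i)) : s = s' := by
  have h1 : hs.pathHom = hs'.pathHom := b.ext_hom _ _ fun i => by
    ext
    · rfl
    · exact h i
  funext g
  exact congrArg LeftSemidirect.snd (DFunLike.congr_fun h1 g)

end IsDerivation

/-- A derivation on a free group can be prescribed on a basis. -/
theorem exists_isDerivation (φ : F →* A.G) (x : ι → A.E) :
    ∃ s, IsDerivation φ s ∧ ∀ i, s (b i) = x i := by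
  let Θ : F →* A.PathGroup := b.lift fun i => ⟨φ (b i), x i⟩
  have hb : ∀ i, Θ (b i) = ⟨φ (b i), x i⟩ := fun i =>
    congrFun (b.lift.symm_apply_apply fun i => (⟨φ (b i), x i⟩ : A.PathGroup)) i
  let π : A.PathGroup →* A.G := ⟨⟨fun p => p.fst, rfl⟩, fun _ _ => rfl⟩
  have h : π.comp Θ = φ := b.ext_hom _ _ fun i => by
    change (Θ (b i)).fst = _
    rw [hb]
  refine ⟨fun g => (Θ g).snd, fun g g' => ?_, fun i => congrArg LeftSemidirect.snd (hb i)⟩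
  have h' : (Θ g').fst = φ g' := DFunLike.congr_fun h g'
  change (Θ (g * g')).snd = _
  rw [map_mul, LeftSemidirect.mul_snd, h', map_inv]
  rfl

/-- The morphism to the triangle group which is `(φ(b), s(b), s'(b), 1)` on the basis. -/
noncomputable def triangleLift (φ : F →* A.G) (s s' : F → A.E) : F →* A.TriangleGroup :=
  b.lift fun i => ⟨⟨φ (b i), s (b i)⟩, ⟨s' (b i), 1⟩⟩

/-- The last component of `triangleLift`. -/
noncomputable def triangleDefect (φ : F →* A.G) (s s' : F → A.E) (g : F) : A.L :=
  (triangleLift b φ s s' g).snd.snd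

variable {φ φ' : F →* A.G} {s s' : F → A.E}

theorem triangleLift_basis (i : ι) :
    triangleLift b φ s s' (b i) = ⟨⟨φ (b i), s (b i)⟩, ⟨s' (b i), 1⟩⟩ :=
  congrFun (b.lift.symm_apply_apply
    fun i => (⟨⟨φ (b i), s (b i)⟩, ⟨s' (b i), 1⟩⟩ : A.TriangleGroup)) i

theorem triangleDefect_basis (i : ι) : triangleDefect b φ s s' (b i) = 1 := by
  rw [triangleDefect, triangleLift_basis]

theorem triangleDefect_one : triangleDefect b φ s s' 1 = 1 := by
  rw [triangleDefect, map_one]; rfl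

theorem triangleLift_fst (hs : IsDerivation φ s) (g : F) :
    (triangleLift b φ s s' g).fst = ⟨φ g, s g⟩ := by
  let π : A.TriangleGroup →* A.PathGroup := ⟨⟨fun p => p.fst, rfl⟩, fun _ _ => rfl⟩
  have h : π.comp (triangleLift b φ s s') = hs.pathHom := b.ext_hom _ _ fun i => by
    change (triangleLift b φ s s' (b i)).fst = _
    rw [triangleLift_basis]; rfl
  exact DFunLike.congr_fun h g

/-- Both sides are morphisms in `g`, and on the basis the last component is `1`, leaving `s'`. -/
theorem triangleTarget_triangleLift (hφ : ∀ g, φ' g = φ g * A.d (s g))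
    (hs' : IsDerivation φ' s') (g : F) :
    A.triangleTarget (triangleLift b φ s s' g) = ⟨φ' g, s' g⟩ := by
  have h : A.triangleTarget.comp (triangleLift b φ s s') = hs'.pathHom :=
    b.ext_hom _ _ fun i => by
      rw [MonoidHom.comp_apply, triangleLift_basis]
      ext <;> simp [triangleTarget, IsDerivation.pathHom, hφ]
  exact DFunLike.congr_fun h g

theorem triangleLift_snd_fst (hφ : ∀ g, φ' g = φ g * A.d (s g)) (hs' : IsDerivation φ' s')
    (g : F) :
    (triangleLift b φ s s' g).snd.fst = s' g * (A.δ (triangleDefect b φ s s' g))⁻¹ :=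
  eq_mul_inv_of_mul_eq
    (congrArg LeftSemidirect.snd (triangleTarget_triangleLift b hφ hs' g))

theorem triangleLift_eq (hs : IsDerivation φ s) (hφ : ∀ g, φ' g = φ g * A.d (s g))
    (hs' : IsDerivation φ' s') (g : F) :
    triangleLift b φ s s' g = A.triG (φ g) * A.triFst (s g) * A.triSnd (s' g) *
      A.triKer (triangleDefect b φ s s' g) := by
  rw [A.tri_eq (triangleLift b φ s s' g), triangleLift_fst b hs, triangleLift_snd_fst b hφ hs',
    triKer, map_mul A.triSnd, map_inv A.triSnd]
  simp only [mul_assoc]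
  rfl

/-- The composite face of the triangle lift is a morphism to the path group. The correction `(δ
ω)⁻¹` enters because `s'` is the second edge only after multiplication by `δ ω`. -/
theorem isDerivation_comp (hs : IsDerivation φ s) (hφ : ∀ g, φ' g = φ g * A.d (s g))
    (hs' : IsDerivation φ' s') :
    IsDerivation φ fun g => s g * s' g * (A.δ (triangleDefect b φ s s' g))⁻¹ := by
  have h : ∀ g, A.triangleComposite (triangleLift b φ s s' g) =
      ⟨φ g, s g * s' g * (A.δ (triangleDefect b φ s s' g))⁻¹⟩ := fun g => by
    simp only [triangleComposite, MonoidHom.coe_mk, OneHom.coe_mk, triangleLift_fst b hs,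
      triangleLift_snd_fst b hφ hs', mul_assoc]
  intro g g'
  have h1 := congrArg LeftSemidirect.snd
    (map_mul (A.triangleComposite.comp (triangleLift b φ s s')) g g')
  simp only [MonoidHom.comp_apply, h, LeftSemidirect.mul_snd, map_inv] at h1
  exact h1

theorem triangleDefect_mul (hs : IsDerivation φ s) (hφ : ∀ g, φ' g = φ g * A.d (s g))
    (hs' : IsDerivation φ' s') (g h : F) :
    triangleDefect b φ s s' (g * h) = triangleDefect b φ s s' h *
      A.sec (s' h)⁻¹ (A.sec (s h)⁻¹ ((φ h)⁻¹ • triangleDefect b φ s s' g) *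
        A.peiffer (s h)⁻¹ ((φ h)⁻¹ • (s' g)⁻¹)) := by
  have h1 : triangleDefect b φ s s' (g * h) =
      A.sec (triangleLift b φ s s' h).snd.fst⁻¹
        (A.liftedFun (triangleLift b φ s s' h).fst⁻¹ (triangleLift b φ s s' g).snd).snd *
          triangleDefect b φ s s' h := by
    rw [triangleDefect, map_mul]; rfl
  rw [h1, triangleLift_snd_fst b hφ hs', triangleLift_fst b hs, liftedFun,
    triangleLift_snd_fst b hφ hs']
  change A.sec _ ((φ h)⁻¹ • (A.peiffer (φ h • (s h)⁻¹) _ *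
    A.d (φ h • (s h)⁻¹) • triangleDefect b φ s s' g)) * _ = _
  have h2 : (φ h)⁻¹ * A.d (φ h • (s h)⁻¹) = A.d (s h)⁻¹ * (φ h)⁻¹ := by rw [A.d_smul]; group
  rw [smul_mul', A.smul_peiffer, inv_smul_smul, smul_smul, h2, mul_smul,
    mul_inv_rev (s' g), inv_inv, smul_mul', ← A.δ_smul, peiffer_δ_mul_right, inv_mul_cancel_right, mul_inv_rev (s' h), inv_inv,
    sec_mul_left, sec_δ, inv_mul_cancel_right]

/-- The lift of `g * m * g⁻¹` is a conjugate; removing the factor `φ g` from `G` brings this into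
the shape of the hypothesis of `derivAct_comp`. -/
theorem triangleDefect_conj (hs : IsDerivation φ s) (hφ : ∀ g, φ' g = φ g * A.d (s g))
    (hs' : IsDerivation φ' s') (g m : F) :
    A.triG (φ m) * A.triFst ((φ m)⁻¹ • s g * s m * (s g)⁻¹) *
        A.triSnd ((φ g)⁻¹ • s' (g * m * g⁻¹)) *
        A.triKer ((φ g)⁻¹ • triangleDefect b φ s s' (g * m * g⁻¹)) =
      (A.triFst (s g) * A.triSnd (s' g) * A.triKer (triangleDefect b φ s s' g)) *
        (A.triG (φ m) * A.triFst (s m) * A.triSnd (s' m) *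
          A.triKer (triangleDefect b φ s s' m)) *
        (A.triFst (s g) * A.triSnd (s' g) * A.triKer (triangleDefect b φ s s' g))⁻¹ := by
  have e := triangleLift_eq b hs hφ hs'
  have h1 : triangleLift b φ s s' (g * m * g⁻¹) = triangleLift b φ s s' g *
      triangleLift b φ s s' m * (triangleLift b φ s s' g)⁻¹ := by rw [map_mul, map_mul, map_inv]
  rw [e (g * m * g⁻¹), e g, e m] at h1
  rw [← hs.smul_conj]
  have h2 : A.triKer ((φ g)⁻¹ • triangleDefect b φ s s' (g * m * g⁻¹)) =
      (A.triG (φ g))⁻¹ * A.triKer (triangleDefect b φ s s' (g * m * g⁻¹)) * A.triG (φ g) := by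
    rw [triKer, triKer, A.δ_smul, triSnd_smul, triL_smul, map_inv]; group
  rw [h2, triFst_smul, triSnd_smul, map_inv]
  calc _ = A.triG (φ m) * (A.triG (φ g))⁻¹ * (A.triG (φ (g * m * g⁻¹)))⁻¹ *
      (A.triG (φ (g * m * g⁻¹)) * A.triFst (s (g * m * g⁻¹)) * A.triSnd (s' (g * m * g⁻¹)) *
      A.triKer (triangleDefect b φ s s' (g * m * g⁻¹))) * A.triG (φ g) := by group
    _ = _ := by rw [h1, map_mul, map_mul, map_mul, map_mul, map_inv, map_inv]; group

/-- Uniqueness of solutions of a multiplicative recursion on a free group. -/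
theorem eq_of_recursion {X Y : F → A.L} (σ : F → F → A.L → A.L)
    (hσ : ∀ g h, Function.Injective (σ g h))
    (hX : ∀ g h, X (g * h) = X h * σ g h (X g)) (hY : ∀ g h, Y (g * h) = Y h * σ g h (Y g))
    (hb : ∀ i, X (b i) = Y (b i)) : X = Y := by
  have h1 : X 1 = Y 1 := by
    -- At the unit the recursion says `σ 1 1 (X 1) = 1`, and the same for `Y`.
    apply hσ 1 1
    have h := hX 1 1
    have h' := hY 1 1
    rw [mul_one, left_eq_mul] at h h'
    rw [h, h']
  let H : Subgroup F :=
    { carrier := {g | X g = Y g}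
      one_mem' := h1
      mul_mem' := fun {g h} hg hh => by
        change X (g * h) = Y (g * h)
        rw [hX, hY, show X g = Y g from hg, show X h = Y h from hh]
      inv_mem' := fun {g} hg => by
        change X g⁻¹ = Y g⁻¹
        have h := hX g g⁻¹
        have h' := hY g g⁻¹
        rw [mul_inv_cancel] at h h'
        rw [h1, h', show X g = Y g from hg] at h
        exact (mul_right_cancel h).symm }
  have hH : (⊤ : Subgroup F) ≤ H := by
    have h : H.subtype.comp (b.lift fun i => ⟨b i, hb i⟩) = MonoidHom.id F :=
      b.ext_hom _ _ fun i => by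
        rw [MonoidHom.comp_apply]
        exact congrArg Subtype.val (congrFun (b.lift.symm_apply_apply
          fun i => (⟨b i, hb i⟩ : H)) i)
    intro g _
    have := DFunLike.congr_fun h g
    rw [← MonoidHom.id_apply F g, ← this]
    exact Subtype.prop _
  funext g
  exact hH (Subgroup.mem_top g)

end Derivations
end TwoCrossedModule

namespace TwoCrossedModule

/-! ### Peiffer identities behind associativity. -/

section Cocycle

variable (A : TwoCrossedModule.{uL, uE, uG})

/-- Here and in `peiffer_cocycle_left`, the right-hand side applies one fixed map, depending only on
`a b c f k`, to the value at the first argument: `p * q` here, `n * sec f m` there. This is the form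
`eq_of_recursion` needs. -/
theorem peiffer_cocycle_right (a b c f k : A.E) (p q P u : A.L) :
    P * A.sec (A.δ u * (c * b)) (A.sec a p * A.peiffer a (A.δ q * (f * k))) *
        (u * A.sec c (A.sec b (A.d a • q) * A.peiffer b (A.d a • f))) =
      P * u * A.sec c (A.sec b (A.sec a (p * q)) *
        (A.sec b (A.peiffer a (f * k)) * A.peiffer b (A.d a • f))) := by
  rw [peiffer_δ_mul_right, sec_mul_left, sec_δ, sec_mul_left]
  simp only [sec_mul_right, sec_inv, mul_assoc, inv_mul_cancel_left]

theorem peiffer_cocycle_left (a b c f k : A.E) (m n v w : A.L) :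
    w * A.sec c (A.sec (A.δ v * (b * a)) n * A.peiffer (A.δ v * (b * a)) f) *
        A.sec (c * A.d b • A.d a • f) (v * A.sec b (A.sec a m * A.peiffer a k)) =
      w * A.sec c v * A.sec c (A.sec b (A.sec a (n * A.sec f m)) *
        (A.sec b (A.peiffer a (f * k)) * A.peiffer b (A.d a • f))) := by
  have h1 := A.peiffer_mul_sec b (A.d a • f) (A.sec b (A.sec a m * A.peiffer a k))
  have h2 := A.peiffer_mul_sec a f (A.sec a m)
  have h3 : A.sec (b * A.d a • f * b⁻¹) (A.sec b (A.sec a m * A.peiffer a k)) =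
      A.sec b (A.sec (A.d a • f) (A.sec a m)) * A.sec b (A.sec (A.d a • f) (A.peiffer a k)) := by
    simp only [sec_mul_left, sec_inv_sec, sec_mul_right]
  have h4 : A.sec (a * f * a⁻¹) (A.sec a m) = A.sec a (A.sec f m) := by
    simp only [sec_mul_left, sec_inv_sec]
  rw [h3] at h1
  rw [h4] at h2
  have h5 := congrArg (A.sec b) h2
  rw [sec_mul_right, sec_mul_right] at h5
  rw [peiffer_δ_mul_left, map_mul, mul_smul, peiffer_mul_left_sec, sec_mul_left _ (A.δ v), sec_δ,
    sec_mul_left _ b, sec_mul_left _ c, peiffer_mul_right_sec]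
  calc _ = w * A.sec c (v * A.sec b (A.sec a n) * A.sec b (A.peiffer a f) *
        (A.peiffer b (A.d a • f) *
          A.sec (A.d b • A.d a • f) (A.sec b (A.sec a m * A.peiffer a k)))) := by
        simp only [sec_mul_right A c, sec_mul_right A (A.d b • A.d a • f) v, sec_inv, mul_assoc,
          inv_mul_cancel_left]
    _ = w * A.sec c (v * A.sec b (A.sec a n) * (A.sec b (A.peiffer a f) *
          A.sec b (A.sec (A.d a • f) (A.sec a m))) *
          A.sec b (A.sec (A.d a • f) (A.peiffer a k)) * A.peiffer b (A.d a • f)) := by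
        rw [h1]; simp only [mul_assoc]
    _ = _ := by
        rw [h5]; simp only [sec_mul_right, mul_assoc]

end Cocycle

/-! ### Quadratic derivations under concatenation. -/

section Composition

variable {A' : TwoCrossedModule.{uL', uE', uG'}} {A : TwoCrossedModule.{uL, uE, uG}}
  {ι : Type w} (b : FreeGroupBasis ι A'.G) {f f' : Hom A' A}

theorem isQuadraticDerivation_iff {s : A'.G → A.E} {t : A'.E → A.L} :
    IsQuadraticDerivation f s t ↔ IsDerivation f.φ s ∧
      (∀ x y, t (x * y) = A.sec (f.ψ y * s (A'.d y))⁻¹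
        (A.peiffer (f.ψ y) ((f.φ (A'.d y))⁻¹ • (s (A'.d x))⁻¹) * t x) * t y) ∧
      ∀ g x, t (g • x) = f.φ g • A.derivAct (f.ψ x) (s g) (s (A'.d x)) (t x) := by
  simp only [derivAct, smul_mul', smul_smul]
  refine ⟨fun h => ⟨h.s_mul, fun x y => ?_, h.t_smul⟩, fun h => ⟨h.1, fun x y => ?_, h.2.2⟩⟩
  · rw [h.t_mul, map_inv]
  · rw [h.2.1, map_inv]

variable {s s' : A'.G → A.E} {t t' : A'.E → A.L}

/-- Nothing is assumed about `t'`, so the law for `t'` and the law for the composite can be deduced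
from each other. -/
theorem comp_mul (hst : IsQuadraticDerivation f s t)
    (hψ : ∀ a, f'.ψ a = f.ψ a * s (A'.d a) * A.δ (t a))
    (hφ : ∀ g, f'.φ g = f.φ g * A.d (s g)) (hs' : IsDerivation f'.φ s') (x y : A'.E) :
    triangleDefect b f.φ s s' (A'.d (x * y)) * A.sec (s' (A'.d (x * y)))⁻¹ (t (x * y)) *
        (A.sec (f'.ψ y * s' (A'.d y))⁻¹
          (A.peiffer (f'.ψ y) ((f'.φ (A'.d y))⁻¹ • (s' (A'.d x))⁻¹) * t' x) * t' y) =
      A.sec (f.ψ y * (s (A'.d y) * s' (A'.d y) *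
          (A.δ (triangleDefect b f.φ s s' (A'.d y)))⁻¹))⁻¹
        (A.peiffer (f.ψ y) ((f.φ (A'.d y))⁻¹ • (s (A'.d x) * s' (A'.d x) *
          (A.δ (triangleDefect b f.φ s s' (A'.d x)))⁻¹)⁻¹) *
          (triangleDefect b f.φ s s' (A'.d x) * A.sec (s' (A'.d x))⁻¹ (t x) * t' x)) *
        (triangleDefect b f.φ s s' (A'.d y) * A.sec (s' (A'.d y))⁻¹ (t y) * t' y) := by
  obtain ⟨hs, ht, -⟩ := isQuadraticDerivation_iff.1 hst
  have hd : A.d (f.ψ y) = f.φ (A'.d y) := f.d_ψ y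
  rw [map_mul, triangleDefect_mul b hs hφ hs', ht, hs', hψ y, hφ, ← hd]
  generalize triangleDefect b f.φ s s' (A'.d y) = z
  generalize triangleDefect b f.φ s s' (A'.d x) = w
  generalize f.ψ y = q
  generalize s (A'.d y) = y₀
  generalize s' (A'.d y) = y₁
  generalize s (A'.d x) = x₀
  generalize s' (A'.d x) = x₁
  generalize t x = l
  generalize t y = k
  generalize t' x = l'
  generalize t' y = k'
  -- Both sides have the outer shape `z (y₁⁻¹ ▷' …) k'`; this is the identity between the inner
  -- parts.
  have h := A.peiffer_comp_mul q y₀ ((A.d q)⁻¹ • x₁⁻¹) ((A.d q * A.d y₀)⁻¹ • x₁⁻¹)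
    ((A.d q)⁻¹ • x₀⁻¹) ((A.d q)⁻¹ • w) l k l' (by rw [mul_inv_rev, mul_smul, smul_inv_smul])
  rw [smul_inv_smul, smul_inv_smul, A.δ_smul, ← smul_mul', ← smul_mul'] at h
  have e1 : (x₀ * x₁ * (A.δ w)⁻¹)⁻¹ = A.δ w * x₁⁻¹ * x₀⁻¹ := by group
  have e2 : (q * (y₀ * y₁ * (A.δ z)⁻¹))⁻¹ = A.δ z * (y₁⁻¹ * (q * y₀)⁻¹) := by group
  rw [e1, e2, sec_mul_left _ (A.δ z), sec_δ, sec_mul_left _ y₁⁻¹, mul_inv_rev _ y₁,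
    mul_inv_rev _ y₁, sec_mul_left _ y₁⁻¹, sec_mul_left _ y₁⁻¹, ← smul_inv']
  calc _ = z * A.sec y₁⁻¹ (A.sec y₀⁻¹ ((A.d q)⁻¹ • w) * A.peiffer y₀⁻¹ ((A.d q)⁻¹ • x₁⁻¹) *
        A.sec ((A.d q * A.d y₀)⁻¹ • x₁⁻¹)
          (A.sec (q * y₀)⁻¹ (A.peiffer q ((A.d q)⁻¹ • x₀⁻¹) * l) * k) *
        A.sec (q * y₀ * A.δ k)⁻¹ (A.peiffer (q * y₀ * A.δ k)
          ((A.d q * A.d y₀)⁻¹ • x₁⁻¹) * l')) * k' := by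
        simp only [sec_mul_right A y₁⁻¹, mul_assoc]
    _ = _ := by
        rw [h]
        simp only [sec_mul_right A y₁⁻¹, mul_assoc, inv_mul_cancel_left]

theorem comp_smul (hst : IsQuadraticDerivation f s t)
    (hψ : ∀ a, f'.ψ a = f.ψ a * s (A'.d a) * A.δ (t a))
    (hφ : ∀ g, f'.φ g = f.φ g * A.d (s g)) (hs' : IsDerivation f'.φ s') (g : A'.G) (x : A'.E) :
    triangleDefect b f.φ s s' (A'.d (g • x)) * A.sec (s' (A'.d (g • x)))⁻¹ (t (g • x)) *
        f'.φ g • A.derivAct (f'.ψ x) (s' g) (s' (A'.d x)) (t' x) =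
      f.φ g • A.derivAct (f.ψ x) (s g * s' g * (A.δ (triangleDefect b f.φ s s' g))⁻¹)
        (s (A'.d x) * s' (A'.d x) * (A.δ (triangleDefect b f.φ s s' (A'.d x)))⁻¹)
        (triangleDefect b f.φ s s' (A'.d x) * A.sec (s' (A'.d x))⁻¹ (t x) * t' x) := by
  obtain ⟨hs, -, ht⟩ := isQuadraticDerivation_iff.1 hst
  have hc := triangleDefect_conj b hs hφ hs' g (A'.d x)
  rw [← f.d_ψ] at hc
  rw [A'.d_smul, ht, hφ, hψ, ← A.derivAct_comp hc]
  simp only [smul_mul', A.smul_sec, smul_inv_smul, smul_inv', mul_smul]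

/-- From right to left this constructs composites, from left to right inverses. -/
theorem isQuadraticDerivation_comp_iff (hst : IsQuadraticDerivation f s t)
    (hψ : ∀ a, f'.ψ a = f.ψ a * s (A'.d a) * A.δ (t a))
    (hφ : ∀ g, f'.φ g = f.φ g * A.d (s g)) (hs' : IsDerivation f'.φ s') :
    IsQuadraticDerivation f (fun g => s g * s' g * (A.δ (triangleDefect b f.φ s s' g))⁻¹)
      (fun x => triangleDefect b f.φ s s' (A'.d x) * A.sec (s' (A'.d x))⁻¹ (t x) * t' x) ↔
    IsQuadraticDerivation f' s' t' := by
  rw [isQuadraticDerivation_iff, isQuadraticDerivation_iff]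
  refine and_congr (iff_of_true (isDerivation_comp b hst.s_mul hφ hs') hs') (and_congr ?_ ?_)
  · refine forall_congr' fun x => forall_congr' fun y => ?_
    rw [← comp_mul b hst hψ hφ hs', mul_right_inj]
  · refine forall_congr' fun g => forall_congr' fun x => ?_
    rw [← comp_smul b hst hψ hφ hs', mul_right_inj]

end Composition

/-! ### Concatenation of homotopies: units, associativity, inverses. -/

section Homotopies

variable {A' : TwoCrossedModule.{uL', uE', uG'}} {A : TwoCrossedModule.{uL, uE, uG}}
  {ι : Type w} (b : FreeGroupBasis ι A'.G) {f f' f'' f''' : Hom A' A}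

theorem omega_eq (p : Homotopy f f') (q : Homotopy f' f'') :
    omega b p q = triangleDefect b f.φ p.s q.s := rfl

namespace Homotopy

theorem isDerivation (p : Homotopy f f') : IsDerivation f.φ p.s := p.isQuadraticDerivation.s_mul

theorem ext_basis {p q : Homotopy f f'} (hs : ∀ i, p.s (b i) = q.s (b i)) (ht : p.t = q.t) :
    p = q :=
  Homotopy.ext (p.isDerivation.ext_basis b q.isDerivation hs) ht

/-- The unit homotopy. -/
def refl (f : Hom A' A) : Homotopy f f where
  s _ := 1
  t _ := 1
  isQuadraticDerivation :=
    { s_mul := fun g h => by simp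
      t_mul := fun x y => by simp [peiffer_one_right, sec_one_right]
      t_smul := fun g x => by simp [peiffer_one_right, peiffer_one_left, sec_one_right] }
  μ_eq l := by simp
  ψ_eq x := by simp
  φ_eq g := by simp

/-- The concatenation of two homotopies, with respect to a basis. -/
noncomputable def comp (p : Homotopy f f') (q : Homotopy f' f'') : Homotopy f f'' where
  s g := p.s g * q.s g * (A.δ (omega b p q g))⁻¹
  t x := omega b p q (A'.d x) * A.sec (q.s (A'.d x))⁻¹ (p.t x) * q.t x
  isQuadraticDerivation :=
    (isQuadraticDerivation_comp_iff b p.isQuadraticDerivation p.ψ_eq p.φ_eq q.isDerivation).2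
      q.isQuadraticDerivation
  μ_eq l := by
    rw [q.μ_eq, p.μ_eq, A'.d_δ, q.isDerivation.map_one, inv_one, sec_one, omega_eq,
      triangleDefect_one, one_mul, mul_assoc]
  ψ_eq x := by
    rw [q.ψ_eq, p.ψ_eq]
    simp only [map_mul, δ_sec]; group
  φ_eq g := by
    rw [q.φ_eq, p.φ_eq]
    simp only [map_mul, map_inv, A.d_δ]; group

theorem omega_basis (p : Homotopy f f') (q : Homotopy f' f'') (i : ι) : omega b p q (b i) = 1 :=
  triangleDefect_basis b i

theorem refl_s (f : Hom A' A) (g : A'.G) : (refl f).s g = 1 := rfl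

theorem refl_t (f : Hom A' A) (x : A'.E) : (refl f).t x = 1 := rfl

theorem comp_s (p : Homotopy f f') (q : Homotopy f' f'') (g : A'.G) :
    (comp b p q).s g = p.s g * q.s g * (A.δ (omega b p q g))⁻¹ := rfl

theorem comp_t (p : Homotopy f f') (q : Homotopy f' f'') (x : A'.E) :
    (comp b p q).t x = omega b p q (A'.d x) * A.sec (q.s (A'.d x))⁻¹ (p.t x) * q.t x := rfl

theorem comp_s_basis (p : Homotopy f f') (q : Homotopy f' f'') (i : ι) :
    (comp b p q).s (b i) = p.s (b i) * q.s (b i) := by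
  simp [comp_s, omega_basis]

theorem omega_mul (p : Homotopy f f') (q : Homotopy f' f'') (g h : A'.G) :
    omega b p q (g * h) = omega b p q h *
      A.sec (q.s h)⁻¹ (A.sec (p.s h)⁻¹ ((f.φ h)⁻¹ • omega b p q g) *
        A.peiffer (p.s h)⁻¹ ((f.φ h)⁻¹ • (q.s g)⁻¹)) :=
  triangleDefect_mul b p.isDerivation p.φ_eq q.isDerivation g h

/-- The constant `1` solves the recursion because liftings with a trivial argument vanish. -/
theorem omega_refl_right (p : Homotopy f f') : omega b p (refl f') = 1 := by
  refine eq_of_recursion b (fun g h l => A.sec ((refl f').s h)⁻¹ (A.sec (p.s h)⁻¹ ((f.φ h)⁻¹ • l) *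
    A.peiffer (p.s h)⁻¹ ((f.φ h)⁻¹ • ((refl f').s g)⁻¹)))
    (fun g h => (A.sec_injective _).comp ((mul_left_injective _).comp
      ((A.sec_injective _).comp (MulAction.injective _)))) (omega_mul b p (refl f'))
    (fun g h => ?_) fun i => omega_basis b p _ i
  simp [refl, sec_one_right, peiffer_one_right]

theorem omega_refl_left (p : Homotopy f f') : omega b (refl f) p = 1 := by
  refine eq_of_recursion b (fun g h l => A.sec (p.s h)⁻¹ (A.sec ((refl f).s h)⁻¹ ((f.φ h)⁻¹ • l) *
    A.peiffer ((refl f).s h)⁻¹ ((f.φ h)⁻¹ • (p.s g)⁻¹)))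
    (fun g h => (A.sec_injective _).comp ((mul_left_injective _).comp
      ((A.sec_injective _).comp (MulAction.injective _)))) (omega_mul b (refl f) p)
    (fun g h => ?_) fun i => omega_basis b _ p i
  simp [refl, sec_one_right, peiffer_one_left]

theorem comp_refl (p : Homotopy f f') : comp b p (refl f') = p := by
  ext x
  · simp [comp_s, omega_refl_right, refl_s]
  · simp [comp_t, omega_refl_right, refl_s, refl_t, sec_one]

theorem refl_comp (p : Homotopy f f') : comp b (refl f) p = p := by
  ext x
  · simp [comp_s, omega_refl_left, refl_s]
  · simp [comp_t, omega_refl_left, refl_t, sec_one_right]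

/-- The cocycle identity for the defects of pointwise multiplication. -/
theorem omega_assoc (p : Homotopy f f') (q : Homotopy f' f'') (r : Homotopy f'' f''') (g : A'.G) :
    omega b (comp b p q) r g * A.sec (r.s g)⁻¹ (omega b p q g) =
      omega b p (comp b q r) g * omega b q r g := by
  -- The common normal form of the two cocycle lemmas, with `a`, `b`, `c` the inverses of `p.s h`,
  -- `q.s h`, `r.s h`.
  let σ : A'.G → A'.G → A.L → A.L := fun g h l =>
    A.sec (r.s h)⁻¹ (A.sec (q.s h)⁻¹ (A.sec (p.s h)⁻¹ ((f.φ h)⁻¹ • l)) *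
      (A.sec (q.s h)⁻¹ (A.peiffer (p.s h)⁻¹ ((f.φ h)⁻¹ • (r.s g)⁻¹ * (f.φ h)⁻¹ • (q.s g)⁻¹)) *
        A.peiffer (q.s h)⁻¹ (A.d (p.s h)⁻¹ • (f.φ h)⁻¹ • (r.s g)⁻¹)))
  have hφ1 : ∀ h, (f'.φ h)⁻¹ = A.d (p.s h)⁻¹ * (f.φ h)⁻¹ := fun h => by
    rw [p.φ_eq, mul_inv_rev, map_inv]
  have hφ2 : ∀ h, (f''.φ h)⁻¹ = A.d (q.s h)⁻¹ * (A.d (p.s h)⁻¹ * (f.φ h)⁻¹) := fun h => by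
    rw [q.φ_eq, mul_inv_rev, map_inv, hφ1]
  have hinv : ∀ (x y : A.E) (l : A.L), (x * y * (A.δ l)⁻¹)⁻¹ = A.δ l * (y⁻¹ * x⁻¹) :=
    fun x y l => by group
  refine congrFun (eq_of_recursion b (X := fun g =>
    omega b (comp b p q) r g * A.sec (r.s g)⁻¹ (omega b p q g)) (Y := fun g =>
    omega b p (comp b q r) g * omega b q r g) σ (fun g h => (A.sec_injective _).comp
      ((mul_left_injective _).comp ((A.sec_injective _).comp ((A.sec_injective _).comp
        (MulAction.injective _))))) (fun g h => ?_) (fun g h => ?_) fun i => ?_) g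
  · have hr : (r.s (g * h))⁻¹ =
        (r.s h)⁻¹ * A.d (q.s h)⁻¹ • A.d (p.s h)⁻¹ • (f.φ h)⁻¹ • (r.s g)⁻¹ := by
      rw [r.isDerivation, hφ2, mul_inv_rev, mul_smul, mul_smul, smul_inv', smul_inv', smul_inv']
    dsimp only [σ]
    rw [hr, omega_mul, omega_mul, comp_s, hinv, peiffer_cocycle_left, smul_mul', smul_sec]
  · dsimp only [σ]
    rw [omega_mul, omega_mul, comp_s, comp_s, hinv, hinv, hφ1, smul_mul', smul_mul', ← A.δ_smul,
      mul_smul, mul_smul, smul_mul', peiffer_cocycle_right]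
  · simp only [omega_basis, sec_one_right]

theorem omega_comp_left (p : Homotopy f f') (q : Homotopy f' f'') (r : Homotopy f'' f''')
    (g : A'.G) : omega b (comp b p q) r g =
      omega b p (comp b q r) g * omega b q r g * (A.sec (r.s g)⁻¹ (omega b p q g))⁻¹ :=
  eq_mul_inv_of_mul_eq (omega_assoc b p q r g)

theorem comp_assoc (p : Homotopy f f') (q : Homotopy f' f'') (r : Homotopy f'' f''') :
    comp b (comp b p q) r = comp b p (comp b q r) := by
  refine ext_basis b (fun i => by simp only [comp_s_basis, mul_assoc]) (funext fun x => ?_)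
  have h := omega_assoc b p q r (A'.d x)
  have hinv : ∀ (x y : A.E) (l : A.L), (x * y * (A.δ l)⁻¹)⁻¹ = A.δ l * (y⁻¹ * x⁻¹) :=
    fun x y l => by group
  simp only [comp_t, comp_s, hinv, sec_mul_left, sec_δ, sec_mul_right, ← mul_assoc, h,
    inv_mul_cancel_right]

/-- The derivation `s'` is prescribed by inverses on the basis, and `t'` is forced by requiring the
composite to be `1`. Its laws are pulled back from the unit through
`isQuadraticDerivation_comp_iff`. -/
theorem exists_inverse (p : Homotopy f f') : ∃ q : Homotopy f' f, comp b p q = refl f := by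
  obtain ⟨s', hs', hb⟩ := exists_isDerivation b f'.φ fun i => (p.s (b i))⁻¹
  have h1 : (fun g => p.s g * s' g * (A.δ (triangleDefect b f.φ p.s s' g))⁻¹) = fun _ => 1 :=
    (isDerivation_comp b p.isDerivation p.φ_eq hs').ext_basis b (refl f).isDerivation fun i => by
      simp [hb, triangleDefect_basis]
  have h1' : ∀ g, p.s g * s' g * (A.δ (triangleDefect b f.φ p.s s' g))⁻¹ = 1 := congrFun h1
  let t' : A'.E → A.L := fun x =>
    (triangleDefect b f.φ p.s s' (A'.d x) * A.sec (s' (A'.d x))⁻¹ (p.t x))⁻¹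
  have h2 : (fun x => triangleDefect b f.φ p.s s' (A'.d x) * A.sec (s' (A'.d x))⁻¹ (p.t x) *
      t' x) = fun _ => 1 := funext fun x => mul_inv_cancel _
  let q : Homotopy f' f :=
    { s := s'
      t := t'
      isQuadraticDerivation := by
        rw [← isQuadraticDerivation_comp_iff b p.isQuadraticDerivation p.ψ_eq p.φ_eq hs', h1, h2]
        exact (refl f).isQuadraticDerivation
      μ_eq := fun l => by
        simp only [t', A'.d_δ, hs'.map_one, inv_one, sec_one, triangleDefect_one, one_mul,
          p.μ_eq, mul_inv_cancel_right]
      ψ_eq := fun x => by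
        have h := h1' (A'.d x)
        rw [mul_inv_eq_one] at h
        simp only [t', p.ψ_eq, map_inv, map_mul, δ_sec, ← h]
        group
      φ_eq := fun g => by
        have h := congrArg A.d (h1' g)
        simp only [map_mul, map_inv, A.d_δ, inv_one, mul_one, map_one] at h
        rw [p.φ_eq, mul_assoc, h, mul_one] }
  exact ⟨q, Homotopy.ext h1 h2⟩

end Homotopy
end Homotopies
end TwoCrossedModule

namespace TwoCrossedModule

/-! ### Peiffer identities behind whiskering. -/

section Whiskering

variable (A : TwoCrossedModule.{uL, uE, uG})

/-- The right-hand side is the 2-derivation law: `n * sec f κ * n₂⁻¹` is the translated value of the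
whiskered map at `g`, the last bracket its value at `h`. The factor `δ k⁻¹ * e` is the inverse of
the target homotopy. -/
theorem whiskerRight_identity (c e f : A.E) (n n₂ κ k w₁ w₂ : A.L) :
    w₁ * A.sec c (A.sec e n * A.peiffer e f) * A.sec (c * A.d e • f) (A.sec e κ * k) *
        (w₂ * A.sec c (A.sec (A.δ k⁻¹ * e) n₂ * A.peiffer (A.δ k⁻¹ * e) f))⁻¹ =
      A.sec (A.δ w₁ * (c * e)) (n * A.sec f κ * n₂⁻¹) * (w₁ * A.sec c k * w₂⁻¹) := by
  have h := A.peiffer_mul_sec e f (A.sec e κ)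
  have h' : A.sec (e * f * e⁻¹) (A.sec e κ) = A.sec e (A.sec f κ) := by
    simp only [sec_mul_left, sec_inv_sec]
  rw [h', ← eq_inv_mul_iff_mul_eq] at h
  rw [peiffer_δ_mul_left, sec_mul_left _ (A.δ k⁻¹), sec_mul_left _ (A.δ w₁), sec_δ, sec_δ,
    sec_mul_left _ c, sec_mul_left _ c, sec_mul_right _ (A.d e • f), h]
  simp only [sec_mul_right, sec_inv]
  group

theorem whiskerLeft_identity (a c f : A.E) (n n₂ κ k w₁ w₂ : A.L) :
    w₁ * A.sec c (A.sec a n * A.peiffer a f) * (A.sec c (A.d a • κ) * k) *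
        (w₂ * A.sec (A.δ k⁻¹ * c) (A.sec a n₂ * A.peiffer a (A.δ κ⁻¹ * f)))⁻¹ =
      A.sec (A.δ w₁ * (c * a)) (n * κ * n₂⁻¹) * (w₁ * k * w₂⁻¹) := by
  rw [peiffer_δ_mul_right, sec_mul_left _ (A.δ k⁻¹), sec_mul_left _ (A.δ w₁), sec_δ, sec_δ,
    sec_mul_left _ c, smul_inv']
  simp only [sec_mul_right, sec_inv]
  group

end Whiskering

/-! ### 2-fold homotopies and the bicategory. -/

section TwoFold

variable {A' : TwoCrossedModule.{uL', uE', uG'}} {A : TwoCrossedModule.{uL, uE, uG}}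
  {ι : Type w} (b : FreeGroupBasis ι A'.G) {f f' f'' f''' : Hom A' A}

namespace TwoFoldHomotopy

/-- The trivial 2-fold homotopy between equal homotopies. -/
def ofEq {p q : Homotopy f f'} (h : p = q) : TwoFoldHomotopy p q where
  k _ := 1
  k_mul g g' := by simp [sec_one_right]
  s_eq g := by simp [h]
  t_eq x := by simp [h]

/-- The vertical composite of 2-fold homotopies. -/
def vcomp {p q r : Homotopy f f'} (α : TwoFoldHomotopy p q) (β : TwoFoldHomotopy q r) :
    TwoFoldHomotopy p r where
  k g := α.k g * β.k g
  k_mul g h := by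
    rw [α.k_mul, β.k_mul, α.s_eq, mul_inv_rev, sec_mul_left, sec_δ_inv, smul_mul', sec_mul_right]
    group
  s_eq g := by rw [β.s_eq, α.s_eq, map_mul, mul_assoc]
  t_eq x := by rw [β.t_eq, α.t_eq, mul_inv_rev, mul_assoc]

/-- The inverse of a 2-fold homotopy. -/
def symm {p q : Homotopy f f'} (α : TwoFoldHomotopy p q) : TwoFoldHomotopy q p where
  k g := (α.k g)⁻¹
  k_mul g h := by
    rw [α.k_mul, α.s_eq, mul_inv_rev (p.s h), sec_mul_left, sec_δ_inv, smul_inv', sec_inv]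
    group
  s_eq g := by rw [α.s_eq, map_inv, mul_inv_cancel_right]
  t_eq x := by rw [α.t_eq, inv_inv, mul_inv_cancel_left]

theorem δ_inv_mul (x y : A.E) (l : A.L) : (x * y * (A.δ l)⁻¹)⁻¹ = A.δ l * (y⁻¹ * x⁻¹) := by group

/-- Whiskering of a 2-fold homotopy with a homotopy on the right, with respect to a basis. -/
noncomputable def whiskerRight {p q : Homotopy f f'} (α : TwoFoldHomotopy p q)
    (r : Homotopy f' f'') : TwoFoldHomotopy (p.comp b r) (q.comp b r) where
  -- The outer factors match the corrections `(δ ω)⁻¹` in the two composites and are `1` on the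
  -- basis.
  k g := omega b p r g * A.sec (r.s g)⁻¹ (α.k g) * (omega b q r g)⁻¹
  k_mul g h := by
    have hr : (r.s (g * h))⁻¹ = (r.s h)⁻¹ * A.d (p.s h)⁻¹ • (f.φ h)⁻¹ • (r.s g)⁻¹ := by
      rw [r.isDerivation, p.φ_eq, mul_inv_rev, mul_inv_rev, mul_smul, smul_inv', smul_inv',
        map_inv]
    rw [hr, Homotopy.omega_mul, Homotopy.omega_mul, α.k_mul, α.s_eq, mul_inv_rev (p.s h),
      ← map_inv A.δ, whiskerRight_identity, Homotopy.comp_s, δ_inv_mul, smul_mul', smul_mul',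
      A.smul_sec, smul_inv' _ (omega b q r g)]
  s_eq g := by
    rw [Homotopy.comp_s, Homotopy.comp_s, α.s_eq]
    simp only [map_mul, map_inv, δ_sec]
    group
  t_eq x := by
    rw [Homotopy.comp_t, Homotopy.comp_t, α.t_eq, sec_mul_right, sec_inv]
    group

/-- Whiskering of a 2-fold homotopy with a homotopy on the left, with respect to a basis. -/
noncomputable def whiskerLeft (r : Homotopy f f') {p q : Homotopy f' f''}
    (α : TwoFoldHomotopy p q) : TwoFoldHomotopy (r.comp b p) (r.comp b q) where
  k g := omega b r p g * α.k g * (omega b r q g)⁻¹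
  k_mul g h := by
    have hk : α.k (g * h) = A.sec (p.s h)⁻¹ (A.d (r.s h)⁻¹ • (f.φ h)⁻¹ • α.k g) * α.k h := by
      rw [α.k_mul, r.φ_eq, mul_inv_rev, mul_smul, map_inv]
    have hs : ∀ g, (q.s g)⁻¹ = A.δ (α.k g)⁻¹ * (p.s g)⁻¹ := fun g => by
      rw [α.s_eq, mul_inv_rev, map_inv]
    rw [hk, Homotopy.omega_mul, Homotopy.omega_mul, hs, hs, smul_mul' _ (A.δ _), ← A.δ_smul,
      smul_inv' _ (α.k g), whiskerLeft_identity, Homotopy.comp_s, δ_inv_mul, smul_mul', smul_mul',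
      smul_inv' _ (omega b r q g)]
  s_eq g := by
    rw [Homotopy.comp_s, Homotopy.comp_s, α.s_eq]
    simp only [map_mul, map_inv]
    group
  t_eq x := by
    rw [Homotopy.comp_t, Homotopy.comp_t, α.t_eq, α.s_eq, mul_inv_rev (p.s _), sec_mul_left,
      sec_δ_inv]
    group

end TwoFoldHomotopy

/-- The category of homotopies between two maps and 2-fold homotopies between them. -/
instance homotopyCategory (f f' : Hom A' A) : Category (Homotopy f f') where
  Hom := TwoFoldHomotopy
  id _ := .ofEq rfl
  comp α β := α.vcomp β
  id_comp _ := TwoFoldHomotopy.ext (funext fun _ => one_mul _)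
  comp_id _ := TwoFoldHomotopy.ext (funext fun _ => mul_one _)
  assoc _ _ _ := TwoFoldHomotopy.ext (funext fun _ => mul_assoc _ _ _)

namespace TwoFoldHomotopy

/-- The trivial isomorphism between equal homotopies. -/
def isoOfEq {p q : Homotopy f f'} (h : p = q) : p ≅ q where
  hom := ofEq h
  inv := ofEq h.symm
  hom_inv_id := TwoFoldHomotopy.ext (funext fun _ => one_mul _)
  inv_hom_id := TwoFoldHomotopy.ext (funext fun _ => one_mul _)

/-- Strictness asks for `eqToIso`, while `isoOfEq` has component `1` by definition, which keeps the
coherence axioms pointwise. -/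
theorem isoOfEq_eq {p q : Homotopy f f'} (h : p = q) : isoOfEq h = eqToIso h := by
  subst h; rfl

@[ext]
theorem hom_ext {p q : Homotopy f f'} {α β : p ⟶ q}
    (h : ∀ g, TwoFoldHomotopy.k α g = TwoFoldHomotopy.k β g) : α = β :=
  TwoFoldHomotopy.ext (funext h)

theorem comp_k {p q r : Homotopy f f'} (α : p ⟶ q) (β : q ⟶ r) (g : A'.G) :
    TwoFoldHomotopy.k (α ≫ β) g = TwoFoldHomotopy.k α g * TwoFoldHomotopy.k β g := rfl

theorem id_k (p : Homotopy f f') (g : A'.G) : TwoFoldHomotopy.k (𝟙 p) g = 1 := rfl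

theorem isoOfEq_hom_k {p q : Homotopy f f'} (h : p = q) (g : A'.G) :
    TwoFoldHomotopy.k (isoOfEq h).hom g = 1 := rfl

theorem isoOfEq_inv_k {p q : Homotopy f f'} (h : p = q) (g : A'.G) :
    TwoFoldHomotopy.k (isoOfEq h).inv g = 1 := rfl

theorem whiskerRight_k {p q : Homotopy f f'} (α : TwoFoldHomotopy p q) (r : Homotopy f' f'')
    (g : A'.G) : (whiskerRight b α r).k g =
      omega b p r g * A.sec (r.s g)⁻¹ (α.k g) * (omega b q r g)⁻¹ := rfl

theorem whiskerLeft_k (r : Homotopy f f') {p q : Homotopy f' f''} (α : TwoFoldHomotopy p q)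
    (g : A'.G) : (whiskerLeft b r α).k g = omega b r p g * α.k g * (omega b r q g)⁻¹ := rfl

end TwoFoldHomotopy

open TwoFoldHomotopy in
/-- The mapping space 2-groupoid, as a bicategory. -/
noncomputable abbrev mappingBicategory :
    Bicategory.{max uG' uL, max uG' uE uE' uL} (Hom A' A) where
  Hom := Homotopy
  id := Homotopy.refl
  comp p q := p.comp b q
  homCategory := homotopyCategory
  whiskerLeft r _ _ α := whiskerLeft b r α
  whiskerRight α r := whiskerRight b α r
  associator p q r := isoOfEq (Homotopy.comp_assoc b p q r)
  leftUnitor p := isoOfEq (Homotopy.refl_comp b p)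
  rightUnitor p := isoOfEq (Homotopy.comp_refl b p)
  whiskerLeft_id r p := by
    ext g
    simp only [whiskerLeft_k, id_k, mul_one, mul_inv_cancel]
  whiskerLeft_comp r _ _ _ α β := by
    ext g
    simp only [whiskerLeft_k, comp_k]; group
  id_whiskerLeft α := by
    ext g
    simp only [whiskerLeft_k, comp_k, isoOfEq_hom_k, isoOfEq_inv_k, Homotopy.omega_refl_left,
      Pi.one_apply]
    group
  comp_whiskerLeft p q r r' α := by
    ext g
    have h : (r'.s g)⁻¹ = A.δ (TwoFoldHomotopy.k α g)⁻¹ * (r.s g)⁻¹ := by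
      rw [TwoFoldHomotopy.s_eq α, mul_inv_rev, map_inv]
    simp only [whiskerLeft_k, comp_k, isoOfEq_hom_k, isoOfEq_inv_k, Homotopy.omega_comp_left, h,
      sec_mul_left, sec_δ]
    group
  id_whiskerRight p r := by
    ext g
    simp only [whiskerRight_k, id_k, sec_one_right, mul_one, mul_inv_cancel]
  comp_whiskerRight α β r := by
    ext g
    simp only [whiskerRight_k, comp_k, sec_mul_right]; group
  whiskerRight_id α := by
    ext g
    simp only [whiskerRight_k, comp_k, isoOfEq_hom_k, isoOfEq_inv_k, Homotopy.omega_refl_right,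
      Pi.one_apply, Homotopy.refl_s, inv_one, sec_one]
    group
  whiskerRight_comp α q r := by
    ext g
    simp only [whiskerRight_k, comp_k, isoOfEq_hom_k, isoOfEq_inv_k, Homotopy.omega_comp_left,
      Homotopy.comp_s, δ_inv_mul, sec_mul_left, sec_mul_right, sec_inv, sec_δ]
    group
  whisker_assoc p q q' α r := by
    ext g
    simp only [whiskerLeft_k, whiskerRight_k, comp_k, isoOfEq_hom_k, isoOfEq_inv_k,
      Homotopy.omega_comp_left, sec_mul_right, sec_inv]
    group
  whisker_exchange {_ _ _ p q r r'} α β := by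
    ext g
    -- Interchange: passing from `r` to `r'` changes the secondary action by a boundary, that is, by
    -- conjugation with `β`.
    have h : (r'.s g)⁻¹ = A.δ (TwoFoldHomotopy.k β g)⁻¹ * (r.s g)⁻¹ := by
      rw [TwoFoldHomotopy.s_eq β, mul_inv_rev, map_inv]
    simp only [whiskerLeft_k, whiskerRight_k, comp_k, h, sec_mul_left, sec_δ]
    group
  pentagon p q r s := by
    ext g
    -- After `Homotopy.comp_assoc` the two `ω` factors of each whiskered associator coincide and
    -- cancel.
    simp only [whiskerLeft_k, whiskerRight_k, comp_k, isoOfEq_hom_k, sec_one_right,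
      Homotopy.comp_assoc, mul_one, mul_inv_cancel]
  triangle p q := by
    ext g
    simp only [whiskerLeft_k, whiskerRight_k, comp_k, isoOfEq_hom_k, sec_one_right,
      Homotopy.comp_refl, Homotopy.refl_comp, mul_one, mul_inv_cancel]

theorem mappingBicategory_isTwoGroupoid :
    @IsTwoGroupoid (Hom A' A) (mappingBicategory b) := by
  let := mappingBicategory (A := A) b
  refine ⟨⟨fun p => Homotopy.refl_comp b p, fun p => Homotopy.comp_refl b p,
    fun p q r => Homotopy.comp_assoc b p q r, fun p => TwoFoldHomotopy.isoOfEq_eq _,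
    fun p => TwoFoldHomotopy.isoOfEq_eq _, fun p q r => TwoFoldHomotopy.isoOfEq_eq _⟩,
    fun p => ?_, fun f f' => ⟨fun {p q} α => ?_⟩⟩
  -- The right inverse `q` has a right inverse itself, which must be `p`.
  · obtain ⟨q, hq⟩ := Homotopy.exists_inverse b p
    obtain ⟨r, hr⟩ := Homotopy.exists_inverse b q
    have h : r = p := by
      rw [← Homotopy.refl_comp b r, ← hq, Homotopy.comp_assoc, hr, Homotopy.comp_refl]
    exact ⟨q, hq, h ▸ hr⟩
  · exact ⟨TwoFoldHomotopy.symm α, TwoFoldHomotopy.ext (funext fun _ => mul_inv_cancel _),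
      TwoFoldHomotopy.ext (funext fun _ => inv_mul_cancel _)⟩

theorem isMappingTwoGroupoid_mappingBicategory :
    IsMappingTwoGroupoid b (mappingBicategory (A := A) b) (Equiv.refl _) (Equiv.refl _) where
  isTwoGroupoid := mappingBicategory_isTwoGroupoid b
  id_s _ _ := rfl
  id_t _ _ := rfl
  comp_s p q i := Homotopy.comp_s_basis b p q i
  comp_t _ _ _ := rfl
  id_k _ _ := rfl
  comp_k _ _ _ := rfl
  whiskerRight_k α r i := by
    refine (TwoFoldHomotopy.whiskerRight_k b α r (b i)).trans ?_
    rw [Homotopy.omega_basis, Homotopy.omega_basis, one_mul, inv_one, mul_one]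
    rfl
  whiskerLeft_k r _ _ α i := by
    refine (TwoFoldHomotopy.whiskerLeft_k b r α (b i)).trans ?_
    rw [Homotopy.omega_basis, Homotopy.omega_basis, one_mul, inv_one, mul_one]
    rfl

end TwoFold

/-! ### A test case for dependence on the basis. -/

section Dependence

/-- The trivial action of a group on another group. -/
abbrev trivialAction (G : Type u) (N : Type v) [Group G] [Group N] :
    MulDistribMulAction G N where
  smul _ n := n
  one_smul _ := rfl
  mul_smul _ _ _ := rfl
  smul_mul _ _ _ := rfl
  smul_one _ := rfl

/-- A group, seen as a 2-crossed module concentrated in the lowest degree. -/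
def ofGroup (F : Type uG) [Group F] : TwoCrossedModule.{uL, uE, uG} where
  L := PUnit
  E := PUnit
  G := F
  actL := trivialAction _ _
  actE := trivialAction _ _
  δ := 1
  d := 1
  peiffer _ _ := 1
  d_δ _ := rfl
  δ_smul _ _ := rfl
  d_smul g _ := by simp
  smul_peiffer _ _ _ := rfl
  δ_peiffer _ _ := rfl
  peiffer_δ_δ _ _ := rfl
  peiffer_δ_mul_peiffer_δ _ _ := rfl
  peiffer_mul_left _ _ _ := rfl
  peiffer_mul_right _ _ _ := rfl

/-- The 2-crossed module `N = N → 1` of a group `N`, with the commutator as Peiffer lifting. -/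
def ofCommutator (N : Type u) [Group N] : TwoCrossedModule.{u, u, v} where
  L := N
  E := N
  G := PUnit
  actL := trivialAction _ _
  actE := trivialAction _ _
  δ := MonoidHom.id N
  d := 1
  peiffer e f := e * f * e⁻¹ * f⁻¹
  d_δ _ := rfl
  δ_smul _ _ := rfl
  d_smul _ _ := rfl
  smul_peiffer _ _ _ := rfl
  δ_peiffer _ _ := rfl
  peiffer_δ_δ _ _ := rfl
  peiffer_δ_mul_peiffer_δ e l := by
    change l * e * l⁻¹ * e⁻¹ * (e * l * e⁻¹ * l⁻¹) = l * l⁻¹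
    group
  peiffer_mul_left e f g := by
    change e * f * g * (e * f)⁻¹ * g⁻¹ =
      e * (f * g * f⁻¹) * e⁻¹ * (f * g * f⁻¹)⁻¹ * (f * g * f⁻¹ * g⁻¹)
    group
  peiffer_mul_right e f g := by
    change e * (f * g) * e⁻¹ * (f * g)⁻¹ = e * f * e⁻¹ * f⁻¹ * (e * g * e⁻¹ * g⁻¹ *
      ((e * g * e⁻¹ * g⁻¹)⁻¹ * f * (e * g * e⁻¹ * g⁻¹)⁻¹⁻¹ * f⁻¹))
    group

/-- The trivial map of 2-crossed modules. -/
def Hom.trivial (A' : TwoCrossedModule.{uL', uE', uG'}) (A : TwoCrossedModule.{uL, uE, uG}) :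
    Hom A' A where
  μ := 1
  ψ := 1
  φ := 1
  δ_μ _ := by simp
  d_ψ _ := by simp
  μ_smul _ _ := by simp
  ψ_smul _ _ := by simp
  μ_peiffer _ _ := by simp [peiffer_one_left]

/-- A morphism to `N` as a self-homotopy of the trivial map. -/
def homotopyOfHom {F : Type uG'} [Group F] {N : Type u} [Group N] (s : F →* N) :
    Homotopy (Hom.trivial (ofGroup.{uL', uE'} F) (ofCommutator.{u, v} N)) (Hom.trivial _ _) where
  s := s
  t _ := 1
  isQuadraticDerivation := by
    have h1 : ∀ x, s ((ofGroup.{uL', uE'} F).d x) = (1 : (ofCommutator.{u, v} N).E) :=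
      fun _ => map_one s
    refine isQuadraticDerivation_iff.2 ⟨fun g h => map_mul s g h, fun x y => ?_, fun g x => ?_⟩
    · simp [h1, Hom.trivial, peiffer_one_left, sec_one_right]
    · simp [h1, Hom.trivial, derivAct, peiffer_one_left, sec_one_right]
      exact ((ofCommutator.{u, v} N).peiffer_one_right (s g)).symm
  μ_eq _ := by simp
  ψ_eq x := by
    have h1 : s ((ofGroup.{uL', uE'} F).d x) = (1 : (ofCommutator.{u, v} N).E) := map_one s
    simp [h1]
  φ_eq _ := rfl

end Dependence

end TwoCrossedModule

theorem mainTheorem1 :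
    (∀ (A' : TwoCrossedModule.{uL', uE', uG'}) (A : TwoCrossedModule.{uL, uE, uG})
        (ι : Type w) (b : FreeGroupBasis ι A'.G),
      ∃ (C : CategoryTheory.Bicategory.{max uG' uL, max uG' uE uE' uL}
            (TwoCrossedModule.Hom A' A))
        (Φ : ∀ {f f' : TwoCrossedModule.Hom A' A},
          (f ⟶ f') ≃ TwoCrossedModule.Homotopy f f')
        (Ψ : ∀ {f f' : TwoCrossedModule.Hom A' A} {p q : f ⟶ f'},
          (p ⟶ q) ≃ TwoCrossedModule.TwoFoldHomotopy (Φ p) (Φ q)),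
        TwoCrossedModule.IsMappingTwoGroupoid b C Φ Ψ) ∧
    (∃ (A' A : TwoCrossedModule.{0, 0, 0}) (ι : Type) (b b' : FreeGroupBasis ι A'.G),
      ¬ ∃ (C : CategoryTheory.Bicategory.{0, 0} (TwoCrossedModule.Hom A' A))
        (Φ : ∀ {f f' : TwoCrossedModule.Hom A' A},
          (f ⟶ f') ≃ TwoCrossedModule.Homotopy f f')
        (Ψ : ∀ {f f' : TwoCrossedModule.Hom A' A} {p q : f ⟶ f'},
          (p ⟶ q) ≃ TwoCrossedModule.TwoFoldHomotopy (Φ p) (Φ q)),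
        TwoCrossedModule.IsMappingTwoGroupoid b C Φ Ψ ∧
          TwoCrossedModule.IsMappingTwoGroupoid b' C Φ Ψ) := by
  refine ⟨fun A' A ι b => ⟨_, _, _,
    TwoCrossedModule.isMappingTwoGroupoid_mappingBicategory b⟩, ?_⟩
  -- Inversion of the generator supplies the second basis.
  let inv : FreeGroup Unit →* FreeGroup Unit := FreeGroup.lift fun i => (FreeGroup.of i)⁻¹
  let invEquiv : FreeGroup Unit ≃* FreeGroup Unit :=
    inv.toMulEquiv inv (by ext; simp [inv]) (by ext; simp [inv])
  let b : FreeGroupBasis Unit (FreeGroup Unit) := .ofFreeGroup Unit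
  refine ⟨TwoCrossedModule.ofGroup (FreeGroup Unit),
    TwoCrossedModule.ofCommutator (Equiv.Perm (Fin 3)), Unit, b, b.map invEquiv, ?_⟩
  rintro ⟨C, Φ, Ψ, h, h'⟩
  let hom (σ : Equiv.Perm (Fin 3)) : FreeGroup Unit →* Equiv.Perm (Fin 3) :=
    FreeGroup.lift fun _ => σ
  let H (σ : Equiv.Perm (Fin 3)) := TwoCrossedModule.homotopyOfHom (hom σ)
  -- The concatenation of the homotopies of `σ` and `τ` is `σ * τ` at the generator by the first
  -- basis, and `σ⁻¹ * τ⁻¹` at its inverse by the second.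
  have key : ∀ σ τ : Equiv.Perm (Fin 3), σ⁻¹ * τ⁻¹ = (σ * τ)⁻¹ := by
    intro σ τ
    have e1 := h.comp_s (Φ.symm (H σ)) (Φ.symm (H τ)) ()
    have e2 := h'.comp_s (Φ.symm (H σ)) (Φ.symm (H τ)) ()
    rw [Equiv.apply_symm_apply, Equiv.apply_symm_apply] at e1 e2
    have hd := (Φ (Φ.symm (H σ) ≫ Φ.symm (H τ))).isDerivation
    have h1 : ∀ ρ, (H ρ).s (b ()) = ρ := fun ρ => by
      change hom ρ (FreeGroup.of ()) = ρ
      simp [hom]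
    have h2 : ∀ ρ, (H ρ).s (b ())⁻¹ = ρ⁻¹ := fun ρ => by
      change hom ρ (FreeGroup.of ())⁻¹ = ρ⁻¹
      simp [hom]
    have hinv : b.map invEquiv () = (b ())⁻¹ := by
      change inv (FreeGroup.of ()) = _
      simp [inv, b]
    set S : FreeGroup Unit → Equiv.Perm (Fin 3) :=
      (Φ (Φ.symm (H σ) ≫ Φ.symm (H τ))).s with hS
    -- The target has trivial `G`, so a derivation is a morphism.
    have hS_mul : ∀ x y, S (x * y) = S x * S y := fun x y => hd x y
    have hS_one : S 1 = 1 := by simpa using hS_mul 1 1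
    have hS_b : S (b ()) = σ * τ := e1.trans (congrArg₂ (· * ·) (h1 σ) (h1 τ))
    have hS_inv : S (b ())⁻¹ = σ⁻¹ * τ⁻¹ :=
      (congrArg S hinv.symm).trans <| e2.trans <| congrArg₂ (· * ·)
        ((congrArg (H σ).s hinv).trans (h2 σ)) ((congrArg (H τ).s hinv).trans (h2 τ))
    rw [← hS_inv, ← hS_b, eq_inv_iff_mul_eq_one, ← hS_mul, inv_mul_cancel, hS_one]
  exact absurd (key (Equiv.swap 0 1) (Equiv.swap 1 2)) (by decide)
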